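/- An $\mathbb{R}$-tree is a metric space $T$ in which any two points are joined by a unique geodesic segment and in which the union of two geodesic segments meeting only at a common end-point is again a geodesic segment. It is leafless if every geodesic segment is contained in an isometric image of $\mathbb{R}$. A ray is an isometric image of $[0,\infty)$. Two rays are equivalent if their intersection is a ray; the equivalence classes are the ends of $T$, and $\partial_\infty T$ denotes the set of ends. Two rays starting at a point $x$ locally coincide if they have more than just $x$ in common; the valency of $x$ is the number of equivalence classes of rays starting at $x$ under this relation. A branch point is a point of valency at least three, and $T$ is locally finite if every point has finite valency. A group acting by isometries on $T$ acts on $\partial_\infty T$ by taking images of rays. Let $G$ be a group acting by isometries on two leafless, locally finite $\mathbb{R}$-trees $(T_1,d_1)$ and $(T_2,d_2)$, each with at least three ends. Suppose that $G$ acts two-transitively on $\partial_\infty T_1$ (that is, transitively on ordered pairs of distinct ends), and let $f:\partial_\infty T_1\to\partial_\infty T_2$ be a $G$-equivariant bijection. Then there are a real number $c>0$ and a surjective map $\bar f:T_1\to T_2$ with $c\,d_2(\bar f(x),\bar f(y))=d_1(x,y)$ for all $x,y\in T_1$ (an isometry from $(T_1,d_1)$ onto the rescaled tree $(T_2,c\,d_2)$)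 which induces $f$, that is, $f$ sends the end of each ray $R$ of $T_1$ to the end of the ray $\bar f(R)$ of $T_2$. If $T_1$ has at least two branch points, then the pair $(c,\bar f)$ is unique. -/

import Mathlib

open scoped NNReal

namespace RTree

/-- `S` is a geodesic segment joining `x` to `y`: the image of a path of length `dist x y`
from `x` to `y` which is an isometric embedding of the interval `[0, dist x y]`. -/
def IsSegment {T : Type*} [MetricSpace T] (S : Set T) (x y : T) : Prop :=
  ∃ γ : ℝ → T, γ 0 = x ∧ γ (dist x y) = y ∧
    (∀ s ∈ Set.Icc 0 (dist x y), ∀ t ∈ Set.Icc 0 (dist x y), dist (γ s) (γ t) = |s - t|) ∧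
    γ '' Set.Icc 0 (dist x y) = S

/-- An `ℝ`-tree: a uniquely geodesic metric space in which two geodesic segments that meet
only at a common end-point have a geodesic segment as their union. -/
class IsRTree (T : Type*) [MetricSpace T] : Prop where
  existsUnique_segment : ∀ x y : T, ∃! S : Set T, IsSegment S x y
  union_segment : ∀ (x y z : T) (S S' : Set T), IsSegment S x y → IsSegment S' y z →
    S ∩ S' = {y} → IsSegment (S ∪ S') x z

/-- A line (apartment): an isometric image of `ℝ`. -/
def IsLine {T : Type*} [MetricSpace T] (L : Set T) : Prop :=
  ∃ γ : ℝ → T, Isometry γ ∧ Set.range γ = L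

/-- Extensible geodesics: every geodesic segment is contained in an isometric image of `ℝ`. -/
def IsLeafless (T : Type*) [MetricSpace T] : Prop :=
  ∀ (x y : T) (S : Set T), IsSegment S x y → ∃ L : Set T, IsLine L ∧ S ⊆ L

/-- `R` is a ray starting in `x`: an isometric image of `[0, ∞)` with `0` mapped to `x`. -/
def IsRayFrom {T : Type*} [MetricSpace T] (x : T) (R : Set T) : Prop :=
  ∃ γ : ℝ≥0 → T, Isometry γ ∧ γ 0 = x ∧ Set.range γ = R

/-- `R` is a ray: an isometric image of the closed half-line `[0, ∞)`. -/
def IsRay {T : Type*} [MetricSpace T] (R : Set T) : Prop :=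
  ∃ γ : ℝ≥0 → T, Isometry γ ∧ Set.range γ = R

/-! Facts needed to see that equivalence of rays and local coincidence of rays are
equivalence relations. -/

section facts

variable {T : Type*} [MetricSpace T]

theorem IsSegment.symm {S : Set T} {x y : T} (h : IsSegment S x y) : IsSegment S y x := by
  obtain ⟨γ, h0, h1, hd, hS⟩ := h
  refine ⟨fun s => γ (dist x y - s), ?_, ?_, ?_, ?_⟩
  · simpa using h1
  · simpa [dist_comm y x] using h0
  · intro s hs t ht
    rw [dist_comm y x] at hs ht
    rw [hd _ ⟨by linarith [hs.2], by linarith [hs.1]⟩ _ ⟨by linarith [ht.2], by linarith [ht.1]⟩,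
      abs_sub_comm]
    congr 1
    ring
  · rw [← hS, dist_comm y x]
    ext p
    constructor
    · rintro ⟨s, hs, rfl⟩
      exact ⟨_, ⟨by linarith [hs.2], by linarith [hs.1]⟩, rfl⟩
    · rintro ⟨s, hs, rfl⟩
      exact ⟨dist x y - s, ⟨by linarith [hs.2], by linarith [hs.1]⟩, by simp⟩

theorem isSegment_of_isometry {γ : ℝ≥0 → T} (hγ : Isometry γ) {a b : ℝ≥0} (hab : a ≤ b) :
    IsSegment (γ '' Set.Icc a b) (γ a) (γ b) := by
  have hab' : (a : ℝ) ≤ b := by exact_mod_cast hab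
  have hdist : dist (γ a) (γ b) = (b : ℝ) - a := by
    rw [hγ.dist_eq, NNReal.dist_eq, abs_sub_comm, abs_of_nonneg (by linarith)]
  refine ⟨fun s => γ (a + s.toNNReal), by simp, ?_, ?_, ?_⟩
  · rw [hdist]
    refine congrArg γ (NNReal.eq ?_)
    push_cast
    rw [Real.coe_toNNReal _ (by linarith)]
    ring
  · intro s hs t ht
    rw [hγ.dist_eq, NNReal.dist_eq]
    push_cast
    rw [Real.coe_toNNReal _ hs.1, Real.coe_toNNReal _ ht.1]
    congr 1
    ring
  · rw [hdist]
    ext p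
    constructor
    · rintro ⟨s, hs, rfl⟩
      refine ⟨_, ⟨by simp, ?_⟩, rfl⟩
      rw [← NNReal.coe_le_coe]
      push_cast
      rw [Real.coe_toNNReal _ hs.1]
      linarith [hs.2]
    · rintro ⟨s, hs, rfl⟩
      have h1 : (a : ℝ) ≤ s := by exact_mod_cast hs.1
      have h2 : (s : ℝ) ≤ b := by exact_mod_cast hs.2
      refine ⟨(s : ℝ) - a, ⟨by linarith, by linarith⟩, ?_⟩
      show γ _ = γ _
      congr 1
      apply NNReal.eq
      push_cast
      rw [Real.coe_toNNReal _ (by linarith)]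
      ring

/-- Rays of a tree are convex. -/
theorem IsRay.segment_subset [IsRTree T] {R S : Set T} {x y : T} (hR : IsRay R)
    (hx : x ∈ R) (hy : y ∈ R) (hS : IsSegment S x y) : S ⊆ R := by
  obtain ⟨γ, hγ, rfl⟩ := hR
  obtain ⟨a, rfl⟩ := hx
  obtain ⟨b, rfl⟩ := hy
  have key : IsSegment (γ '' Set.Icc (min a b) (max a b)) (γ a) (γ b) := by
    rcases le_total a b with h | h
    · simpa [h] using isSegment_of_isometry hγ h
    · simpa [h] using (isSegment_of_isometry hγ h).symm
  rw [(IsRTree.existsUnique_segment (γ a) (γ b)).unique hS key]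
  exact Set.image_subset_range _ _

theorem IsRay.image_Ici {γ : ℝ≥0 → T} (hγ : Isometry γ) (a : ℝ≥0) :
    IsRay (γ '' Set.Ici a) := by
  refine ⟨fun s => γ (a + s), ?_, ?_⟩
  · refine Isometry.of_dist_eq fun s t => ?_
    rw [hγ.dist_eq, NNReal.dist_eq, NNReal.dist_eq]
    push_cast
    congr 1
    ring
  · ext p
    constructor
    · rintro ⟨s, rfl⟩
      exact ⟨a + s, by simp, rfl⟩
    · rintro ⟨s, hs, rfl⟩
      exact ⟨s - a, by simp [add_tsub_cancel_of_le (Set.mem_Ici.1 hs)]⟩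

/-- A ray contained in a ray is a final part of it. -/
theorem IsRay.eq_image_Ici {γ : ℝ≥0 → T} (hγ : Isometry γ) {R : Set T} (hR : IsRay R)
    (hsub : R ⊆ Set.range γ) : ∃ a : ℝ≥0, R = γ '' Set.Ici a := by
  obtain ⟨ρ, hρ, rfl⟩ := hR
  choose σ hσ using fun s => hsub ⟨s, rfl⟩
  have hd : ∀ s t : ℝ≥0, |(σ s : ℝ) - σ t| = |(s : ℝ) - t| := by
    intro s t
    rw [← NNReal.dist_eq, ← NNReal.dist_eq, ← hγ.dist_eq, hσ, hσ, hρ.dist_eq]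
  have hadd : ∀ s : ℝ≥0, (σ s : ℝ) = σ 0 + s := by
    intro s
    set u : ℝ≥0 := σ 0 + s + 1 with hu
    have hu' : (u : ℝ) = σ 0 + s + 1 := by rw [hu]; push_cast; ring
    have e1 := hd s 0
    have e2 := hd u 0
    have e3 := hd u s
    have p0 := (σ 0).coe_nonneg
    have p1 := s.coe_nonneg
    have p2 := (σ u).coe_nonneg
    have p3 := (σ s).coe_nonneg
    rw [hu'] at e2 e3
    simp only [NNReal.coe_zero, sub_zero] at e1 e2
    rw [abs_of_nonneg p1] at e1
    rw [abs_of_nonneg (by linarith : (0 : ℝ) ≤ σ 0 + s + 1)] at e2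
    rw [abs_of_nonneg (by linarith : (0 : ℝ) ≤ σ 0 + s + 1 - s)] at e3
    rcases abs_cases ((σ s : ℝ) - σ 0) with h | h <;>
    rcases abs_cases ((σ u : ℝ) - σ 0) with h' | h' <;>
    rcases abs_cases ((σ u : ℝ) - σ s) with h'' | h'' <;> linarith
  refine ⟨σ 0, ?_⟩
  ext p
  constructor
  · rintro ⟨s, rfl⟩
    refine ⟨σ s, ?_, hσ s⟩
    rw [Set.mem_Ici, ← NNReal.coe_le_coe, hadd s]
    linarith [s.coe_nonneg]
  · rintro ⟨t, ht, rfl⟩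
    refine ⟨t - σ 0, ?_⟩
    rw [← hσ]
    congr 1
    apply NNReal.eq
    rw [hadd, NNReal.coe_sub ht]
    ring

/-- If the intersection of two rays of a tree contains a ray, then it is a ray. -/
theorem IsRay.inter_of_subset [IsRTree T] {R R' Q : Set T} (hR : IsRay R) (hR' : IsRay R')
    (hQ : IsRay Q) (h1 : Q ⊆ R) (h2 : Q ⊆ R') : IsRay (R ∩ R') := by
  obtain ⟨γ, hγ, rfl⟩ := id hR
  obtain ⟨n, rfl⟩ := hQ.eq_image_Ici hγ h1
  have hcl : IsClosed (γ ⁻¹' R') := by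
    obtain ⟨γ', hγ', rfl⟩ := hR'
    exact hγ'.isClosedEmbedding.isClosed_range.preimage hγ.continuous
  have hne : (γ ⁻¹' R').Nonempty := ⟨n, h2 ⟨n, Set.mem_Ici.2 le_rfl, rfl⟩⟩
  have hmem : sInf (γ ⁻¹' R') ∈ γ ⁻¹' R' := hcl.csInf_mem hne (OrderBot.bddBelow _)
  have hpre : γ ⁻¹' R' = Set.Ici (sInf (γ ⁻¹' R')) := by
    ext t
    constructor
    · intro ht
      exact csInf_le (OrderBot.bddBelow _) ht
    · intro ht
      have hb : γ (max t n) ∈ R' := h2 ⟨_, Set.mem_Ici.2 (le_max_right _ _), rfl⟩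
      exact hR'.segment_subset hmem hb
        (isSegment_of_isometry hγ (le_trans (Set.mem_Ici.1 ht) (le_max_left t n)))
        ⟨t, ⟨ht, le_max_left _ _⟩, rfl⟩
  have : Set.range γ ∩ R' = γ '' Set.Ici (sInf (γ ⁻¹' R')) := by
    rw [← hpre, Set.image_preimage_eq_inter_range, Set.inter_comm]
  rw [this]
  exact IsRay.image_Ici hγ _

theorem IsRay.inter_trans [IsRTree T] {R₁ R₂ R₃ : Set T} (h₁ : IsRay R₁) (h₂ : IsRay R₂)
    (h₃ : IsRay R₃) (h₁₂ : IsRay (R₁ ∩ R₂)) (h₂₃ : IsRay (R₂ ∩ R₃)) : IsRay (R₁ ∩ R₃) := by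
  obtain ⟨γ, hγ, rfl⟩ := id h₂
  obtain ⟨a, ha⟩ := h₁₂.eq_image_Ici hγ Set.inter_subset_right
  obtain ⟨b, hb⟩ := h₂₃.eq_image_Ici hγ Set.inter_subset_left
  refine h₁.inter_of_subset h₃ (IsRay.image_Ici hγ (max a b)) ?_ ?_
  · refine (Set.image_mono (Set.Ici_subset_Ici.2 (le_max_left a b))).trans ?_
    rw [← ha]
    exact Set.inter_subset_left
  · refine (Set.image_mono (Set.Ici_subset_Ici.2 (le_max_right a b))).trans ?_
    rw [← hb]
    exact Set.inter_subset_right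

theorem IsRayFrom.isRay {R : Set T} {x : T} (h : IsRayFrom x R) : IsRay R := by
  obtain ⟨γ, hγ, -, hR⟩ := h
  exact ⟨γ, hγ, hR⟩

theorem IsRayFrom.inter_trans [IsRTree T] {x : T} {R₁ R₂ R₃ : Set T} (h₁ : IsRayFrom x R₁)
    (h₂ : IsRayFrom x R₂) (h₃ : IsRayFrom x R₃) (h₁₂ : ∃ y ∈ R₁ ∩ R₂, y ≠ x)
    (h₂₃ : ∃ y ∈ R₂ ∩ R₃, y ≠ x) : ∃ y ∈ R₁ ∩ R₃, y ≠ x := by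
  have r₁ := h₁.isRay
  have r₃ := h₃.isRay
  have m₁ : x ∈ R₁ := by obtain ⟨γ, -, rfl, rfl⟩ := h₁; exact ⟨0, rfl⟩
  have m₃ : x ∈ R₃ := by obtain ⟨γ, -, rfl, rfl⟩ := h₃; exact ⟨0, rfl⟩
  obtain ⟨γ, hγ, rfl, rfl⟩ := h₂
  obtain ⟨y, ⟨hy1, s, rfl⟩, hy⟩ := h₁₂
  obtain ⟨z, ⟨⟨t, rfl⟩, hz3⟩, hz⟩ := h₂₃
  have hs : s ≠ 0 := fun h => hy (by rw [h])
  have ht : t ≠ 0 := fun h => hz (by rw [h])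
  have i1 := r₁.segment_subset m₁ hy1 (isSegment_of_isometry hγ (zero_le : 0 ≤ s))
  have i3 := r₃.segment_subset m₃ hz3 (isSegment_of_isometry hγ (zero_le : 0 ≤ t))
  refine ⟨γ (min s t), ⟨i1 ⟨_, ⟨zero_le, min_le_left _ _⟩, rfl⟩,
    i3 ⟨_, ⟨zero_le, min_le_right _ _⟩, rfl⟩⟩, fun h => ?_⟩
  have h0 : min s t = 0 := hγ.injective h
  rcases min_choice s t with h' | h'
  · exact hs (h' ▸ h0)
  · exact ht (h' ▸ h0)

end facts

/-- Two rays are equivalent if they intersect in a ray. -/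
def raySetoid (T : Type*) [MetricSpace T] [IsRTree T] : Setoid {R : Set T // IsRay R} where
  r R R' := IsRay (R.1 ∩ R'.1)
  iseqv :=
    { refl := fun R => by rw [Set.inter_self]; exact R.2
      symm := fun {R R'} h => by rw [Set.inter_comm]; exact h
      trans := fun {R R' R''} h h' => IsRay.inter_trans R.2 R'.2 R''.2 h h' }

/-- The ends of a tree: equivalence classes of rays. -/
def Ends (T : Type*) [MetricSpace T] [IsRTree T] : Type _ :=
  Quotient (raySetoid T)

/-- Two rays starting in `x` locally coincide if they intersect in more than just `x`. -/
def directionSetoid {T : Type*} [MetricSpace T] [IsRTree T] (x : T) :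
    Setoid {R : Set T // IsRayFrom x R} where
  r R R' := ∃ y ∈ R.1 ∩ R'.1, y ≠ x
  iseqv :=
    { refl := fun R => by
        obtain ⟨γ, hγ, h0, hR⟩ := R.2
        refine ⟨γ 1, ⟨hR ▸ ⟨1, rfl⟩, hR ▸ ⟨1, rfl⟩⟩, fun h => ?_⟩
        exact one_ne_zero (hγ.injective (h.trans h0.symm))
      symm := fun {R R'} h => by
        obtain ⟨y, hy, hyx⟩ := h
        exact ⟨y, ⟨hy.2, hy.1⟩, hyx⟩
      trans := fun {R R' R''} h h' => IsRayFrom.inter_trans R.2 R'.2 R''.2 h h' }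

/-- The space of directions at `x`. -/
def Directions {T : Type*} [MetricSpace T] [IsRTree T] (x : T) : Type _ :=
  Quotient (directionSetoid x)

/-- The valency of a point is the cardinality of its space of directions. -/
noncomputable def valency {T : Type*} [MetricSpace T] [IsRTree T] (x : T) : Cardinal :=
  Cardinal.mk (Directions x)

/-- A branch point is a point of valency at least three. -/
def IsBranchPoint {T : Type*} [MetricSpace T] [IsRTree T] (x : T) : Prop :=
  3 ≤ valency x

/-- A tree is locally finite if no point has infinite valency. -/
def IsLocallyFinite (T : Type*) [MetricSpace T] [IsRTree T] : Prop :=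
  ∀ x : T, valency x < Cardinal.aleph0

/-- `φ` is an isometry from `T₁` onto `T₂` after the metric of `T₂` has been multiplied by
the positive factor `c`. -/
structure IsRescaledIsometry {T₁ T₂ : Type*} [MetricSpace T₁] [MetricSpace T₂]
    (c : ℝ) (φ : T₁ → T₂) : Prop where
  pos : 0 < c
  surjective : Function.Surjective φ
  dist_eq : ∀ x y : T₁, c * dist (φ x) (φ y) = dist x y

section induced

variable {T₁ T₂ : Type*} [MetricSpace T₁] [MetricSpace T₂]

theorem IsRescaledIsometry.injective {c : ℝ} {φ : T₁ → T₂} (h : IsRescaledIsometry c φ) :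
    Function.Injective φ := by
  intro x y hxy
  rw [← dist_eq_zero, ← h.dist_eq, hxy, dist_self, mul_zero]

theorem IsRescaledIsometry.isRay_image {c : ℝ} {φ : T₁ → T₂} (h : IsRescaledIsometry c φ)
    {R : Set T₁} (hR : IsRay R) : IsRay (φ '' R) := by
  obtain ⟨γ, hγ, rfl⟩ := hR
  have hc := h.pos
  refine ⟨fun s => φ (γ (c.toNNReal * s)), ?_, ?_⟩
  · refine Isometry.of_dist_eq fun s t => ?_
    have e := h.dist_eq (γ (c.toNNReal * s)) (γ (c.toNNReal * t))
    rw [hγ.dist_eq, NNReal.dist_eq] at e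
    push_cast at e
    rw [Real.coe_toNNReal _ hc.le, ← mul_sub, abs_mul, abs_of_pos hc] at e
    rw [NNReal.dist_eq]
    exact mul_left_cancel₀ hc.ne' e
  · ext p
    constructor
    · rintro ⟨s, rfl⟩
      exact ⟨_, ⟨_, rfl⟩, rfl⟩
    · rintro ⟨_, ⟨s, rfl⟩, rfl⟩
      refine ⟨c.toNNReal⁻¹ * s, ?_⟩
      show φ (γ _) = φ (γ _)
      rw [mul_inv_cancel_left₀ (Real.toNNReal_pos.2 hc).ne']

/-- The map on ends induced by an isometry (up to rescaling): the end represented by a ray `R`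
is sent to the end represented by the ray `φ '' R`. -/
def IsRescaledIsometry.endsMap [IsRTree T₁] [IsRTree T₂] {c : ℝ} {φ : T₁ → T₂}
    (h : IsRescaledIsometry c φ) : Ends T₁ → Ends T₂ :=
  Quotient.map (sa := raySetoid T₁) (sb := raySetoid T₂)
    (fun R => ⟨φ '' R.1, h.isRay_image R.2⟩) (fun R R' hRR' => by
      show IsRay (φ '' R.1 ∩ φ '' R'.1)
      rw [← Set.image_inter h.injective]
      exact h.isRay_image hRR')

end induced

section action

variable {G T : Type*} [Group G] [MetricSpace T] [MulAction G T] [IsIsometricSMul G T]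

theorem isRescaledIsometry_smul (g : G) : IsRescaledIsometry 1 (fun x : T => g • x) where
  pos := one_pos
  surjective := MulAction.surjective g
  dist_eq x y := by rw [one_mul, dist_smul]

/-- The action on the ends induced by an isometric action on a tree. -/
instance endsMulAction [IsRTree T] : MulAction G (Ends T) where
  smul g e := (isRescaledIsometry_smul (T := T) g).endsMap e
  one_smul e := by
    induction e using Quotient.inductionOn with
    | h R =>
      refine congrArg (Quotient.mk (raySetoid T)) (Subtype.ext ?_)
      show (fun x : T => (1 : G) • x) '' R.1 = R.1
      simp
  mul_smul g g' e := by
    induction e using Quotient.inductionOn with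
    | h R =>
      refine congrArg (Quotient.mk (raySetoid T)) (Subtype.ext ?_)
      show (fun x : T => (g * g') • x) '' R.1
        = (fun x : T => g • x) '' ((fun x : T => g' • x) '' R.1)
      rw [Set.image_image]
      simp only [mul_smul]

end action

end RTree

/-! The metric is encoded at infinity. Write `bus e` for the Busemann cocycle of an end and `gp a b
x` for the Gromov product, the distance of `x` from the line joining `a` and `b`. A leafless tree is
determined by its Gromov products: a point is known from its Busemann values
(`IsLeafless.eq_of_bus`), and distances are maxima of Busemann differences. It therefore suffices to
find `c > 0` and a function `v` on ends with `gp a b p = c * gp (f a) (f b) q + v a + v b`; the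
terms in `v` disappear in differences, and `exists_point` and `exists_isRescaledIsometry` rebuild
the map.

Such a relation comes from translation lengths. If the lengths of all elements fixing an end agree
in the two trees up to a factor `c`, then the failure of `gp - c * gp` to be `G`-invariant is a
cocycle vanishing on stabilisers of ends, hence a coboundary. Subtracting it leaves an invariant
function of pairs of ends, which is constant by two-transitivity (`exists_potential`). The factor is
positive because the four point condition for ends distinguishes the smallest from the largest sum.

Proportionality reduces to a boundedness statement about two homomorphisms to `ℝ` on the stabiliser
of two ends (`exists_ratio_of_bounded`), and this statement, `exists_translation_bound`, is the
heart of the proof. Suppose elements are short in `T₂` but arbitrarily long in `T₁`. By Jordan's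
theorem some `g` fixes a branch point `x` of `T₂` and moves each of the finitely many directions
there, so no element acting on directions at `x` as `g` does can fix an end. Short translations
along two lines that overlap near `x` give commutator-like elements fixing `x`; by pigeonhole two of
them act alike on directions, and they yield a product acting there like `g`. In `T₁` the same
product is built from long translations with different ends, so it is hyperbolic and fixes an end, a
contradiction. -/

namespace RTree

/-! ### Metric geometry of trees: betweenness, medians, hyperbolicity -/

section Geometry

variable {T : Type*} [MetricSpace T]

theorem IsSegment.dist_add_dist {S : Set T} {x y p : T} (h : IsSegment S x y) (hp : p ∈ S) :
    dist x p + dist p y = dist x y := by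
  obtain ⟨γ, h0, h1, hd, rfl⟩ := h
  obtain ⟨s, hs, rfl⟩ := hp
  have e1 := hd 0 ⟨le_rfl, dist_nonneg⟩ s hs
  have e2 := hd s hs _ ⟨dist_nonneg, le_rfl⟩
  rw [h0, zero_sub, abs_neg, abs_of_nonneg hs.1] at e1
  rw [h1, abs_sub_comm, abs_of_nonneg (by linarith [hs.2])] at e2
  rw [e1, e2]
  ring

theorem IsSegment.exists_dist_eq {S : Set T} {x y : T} (h : IsSegment S x y) {s : ℝ}
    (hs : 0 ≤ s) (hs' : s ≤ dist x y) : ∃ p ∈ S, dist x p = s := by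
  obtain ⟨γ, h0, h1, hd, rfl⟩ := h
  refine ⟨γ s, ⟨s, ⟨hs, hs'⟩, rfl⟩, ?_⟩
  have e1 := hd 0 ⟨le_rfl, dist_nonneg⟩ s ⟨hs, hs'⟩
  rwa [h0, zero_sub, abs_neg, abs_of_nonneg hs] at e1

theorem IsSegment.eq_of_dist_eq {S : Set T} {x y p q : T} (h : IsSegment S x y) (hp : p ∈ S)
    (hq : q ∈ S) (hpq : dist x p = dist x q) : p = q := by
  obtain ⟨γ, h0, h1, hd, rfl⟩ := h
  obtain ⟨s, hs, rfl⟩ := hp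
  obtain ⟨t, ht, rfl⟩ := hq
  have e1 := hd 0 ⟨le_rfl, dist_nonneg⟩ s hs
  have e2 := hd 0 ⟨le_rfl, dist_nonneg⟩ t ht
  rw [h0, zero_sub, abs_neg, abs_of_nonneg hs.1] at e1
  rw [h0, zero_sub, abs_neg, abs_of_nonneg ht.1] at e2
  rw [show s = t by linarith]

theorem IsSegment.left_mem {S : Set T} {x y : T} (h : IsSegment S x y) : x ∈ S := by
  obtain ⟨γ, h0, h1, hd, rfl⟩ := h
  exact ⟨0, ⟨le_rfl, dist_nonneg⟩, h0⟩

theorem IsSegment.right_mem {S : Set T} {x y : T} (h : IsSegment S x y) : y ∈ S :=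
  h.symm.left_mem

theorem IsSegment.isCompact {S : Set T} {x y : T} (h : IsSegment S x y) : IsCompact S := by
  obtain ⟨γ, h0, h1, hd, rfl⟩ := h
  refine isCompact_Icc.image_of_continuousOn ?_
  refine (LipschitzOnWith.of_dist_le_mul (K := 1) fun s hs t ht => ?_).continuousOn
  rw [hd s hs t ht, Real.dist_eq, NNReal.coe_one, one_mul]

variable [IsRTree T]

/-- Equality in the triangle inequality makes the segments from `x` to `p` and from `p` to `y` meet
only in `p`, so their union is the segment. Hence segments are metric intervals, and later arguments
can be purely numerical. -/
theorem IsSegment.mem_of_dist_add_dist {S : Set T} {x y p : T} (h : IsSegment S x y)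
    (hp : dist x p + dist p y = dist x y) : p ∈ S := by
  obtain ⟨S₁, h₁, -⟩ := IsRTree.existsUnique_segment x p
  obtain ⟨S₂, h₂, -⟩ := IsRTree.existsUnique_segment p y
  have hi : S₁ ∩ S₂ = {p} := by
    ext q
    constructor
    · rintro ⟨hq1, hq2⟩
      have e1 := h₁.dist_add_dist hq1
      have e2 := h₂.dist_add_dist hq2
      have e3 := dist_triangle x q y
      rw [dist_comm q p] at e1
      have : dist p q = 0 := le_antisymm (by linarith) dist_nonneg
      exact (dist_eq_zero.1 this).symm
    · rintro rfl
      exact ⟨h₁.right_mem, h₂.left_mem⟩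
  rw [(IsRTree.existsUnique_segment x y).unique h (IsRTree.union_segment _ _ _ _ _ h₁ h₂ hi)]
  exact Or.inl h₁.right_mem

theorem exists_between (x y : T) {s : ℝ} (hs : 0 ≤ s) (hs' : s ≤ dist x y) :
    ∃ p, dist x p = s ∧ dist p y = dist x y - s := by
  obtain ⟨S, hS, -⟩ := IsRTree.existsUnique_segment x y
  obtain ⟨p, hp, h⟩ := hS.exists_dist_eq hs hs'
  exact ⟨p, h, by linarith [hS.dist_add_dist hp]⟩

theorem eq_of_between {x y p q : T} (hp : dist x p + dist p y = dist x y)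
    (hq : dist x q + dist q y = dist x y) (hpq : dist x p = dist x q) : p = q := by
  obtain ⟨S, hS, -⟩ := IsRTree.existsUnique_segment x y
  exact hS.eq_of_dist_eq (hS.mem_of_dist_add_dist hp) (hS.mem_of_dist_add_dist hq) hpq

/-- Every triple of points of a tree has a median. -/
theorem exists_median (x y z : T) : ∃ w, dist x w + dist w y = dist x y ∧
    dist x w + dist w z = dist x z ∧ dist y w + dist w z = dist y z := by
  obtain ⟨S, hS, -⟩ := IsRTree.existsUnique_segment x y
  obtain ⟨S', hS', -⟩ := IsRTree.existsUnique_segment x z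
  -- The median is the last common point of the segments from `x` to `y` and from `x` to `z`.
  have hc : IsCompact (S ∩ S') := hS.isCompact.inter hS'.isCompact
  obtain ⟨w, ⟨hw, hw'⟩, hmax⟩ := hc.exists_isMaxOn ⟨x, hS.left_mem, hS'.left_mem⟩
    (f := fun p => dist x p) (by fun_prop)
  have e1 := hS.dist_add_dist hw
  have e2 := hS'.dist_add_dist hw'
  refine ⟨w, e1, e2, ?_⟩
  obtain ⟨S₁, h₁, -⟩ := IsRTree.existsUnique_segment y w
  obtain ⟨S₂, h₂, -⟩ := IsRTree.existsUnique_segment w z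
  have hi : S₁ ∩ S₂ = {w} := by
    ext q
    constructor
    · rintro ⟨hq1, hq2⟩
      have f1 := h₁.dist_add_dist hq1
      have f2 := h₂.dist_add_dist hq2
      have t1 := dist_triangle x w q
      have t2 := dist_triangle x q y
      have t3 := dist_triangle x q z
      have c1 := dist_comm y q
      have c2 := dist_comm q w
      have c3 := dist_comm y w
      have hq : q ∈ S ∩ S' :=
        ⟨hS.mem_of_dist_add_dist (by linarith), hS'.mem_of_dist_add_dist (by linarith)⟩
      have hm : dist x q ≤ dist x w := hmax hq
      have : dist w q = 0 := le_antisymm (by linarith) dist_nonneg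
      exact (dist_eq_zero.1 this).symm
    · rintro rfl
      exact ⟨h₁.right_mem, h₂.left_mem⟩
  exact (IsRTree.union_segment _ _ _ _ _ h₁ h₂ hi).dist_add_dist (Or.inl h₁.right_mem)

/-- Two geodesics issuing from `x` coincide up to the Gromov product of their end-points. -/
theorem eq_of_le_gromov {x y z p q : T} (hp : dist x p + dist p y = dist x y)
    (hq : dist x q + dist q z = dist x z) (hpq : dist x p = dist x q)
    (h : 2 * dist x p ≤ dist x y + dist x z - dist y z) : p = q := by
  obtain ⟨w, h1, h2, h3⟩ := exists_median x y z
  have c1 := dist_comm y w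
  obtain ⟨r, r1, r2⟩ := exists_between x w (dist_nonneg (x := x) (y := p)) (by linarith)
  have t1 := dist_triangle x r y
  have t2 := dist_triangle x r z
  have t3 := dist_triangle r w y
  have t4 := dist_triangle r w z
  have e1 : p = r := eq_of_between hp (by linarith) r1.symm
  have e2 : q = r := eq_of_between hq (by linarith) (by linarith)
  rw [e1, e2]

/-- Trees are `0`-hyperbolic. -/
theorem gromov_min_le (x y z w : T) :
    min (dist x y + dist x z - dist y z) (dist x z + dist x w - dist z w) ≤
      dist x y + dist x w - dist y w := by
  set m := min (dist x y + dist x z - dist y z) (dist x z + dist x w - dist z w) with hm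
  have m1 : m ≤ dist x y + dist x z - dist y z := min_le_left _ _
  have m2 : m ≤ dist x z + dist x w - dist z w := min_le_right _ _
  have m0 : 0 ≤ m := by
    refine le_min ?_ ?_
    · linarith [dist_triangle y x z, dist_comm x y]
    · linarith [dist_triangle z x w, dist_comm x z]
  have t1 := dist_triangle x z y
  have t2 := dist_triangle x y z
  have t3 := dist_triangle x w z
  have c1 := dist_comm y z
  have c2 := dist_comm z w
  -- The three geodesics from `x` still coincide at distance `m / 2`, so `y` and `w` are joined
  -- through this common point.
  obtain ⟨p, p1, p2⟩ := exists_between x y (s := m / 2) (by linarith) (by linarith)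
  obtain ⟨q, q1, q2⟩ := exists_between x z (s := m / 2) (by linarith) (by linarith)
  obtain ⟨r, r1, r2⟩ := exists_between x w (s := m / 2) (by linarith) (by linarith)
  have e1 : p = q := eq_of_le_gromov (by linarith) (by linarith) (by linarith) (by linarith)
  have e2 : q = r := eq_of_le_gromov (by linarith) (by linarith) (by linarith) (by linarith)
  subst e1 e2
  linarith [dist_triangle y p w, dist_comm y p]

/-- The four point condition. -/
theorem four_point (x y z w : T) :
    dist x y + dist z w ≤ max (dist x z + dist y w) (dist x w + dist y z) := by
  have h := gromov_min_le x z y w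
  have c := dist_comm y z
  rcases min_le_iff.1 h with h | h
  · exact le_max_of_le_right (by linarith)
  · exact le_max_of_le_left (by linarith)

end Geometry

/-! ### Geodesic rays, ends and Busemann functions -/

section Rays

variable {T : Type*} [MetricSpace T]

/-- `γ` restricts to an isometric embedding of `[0, ∞)`. -/
def IsGeodRay (γ : ℝ → T) : Prop :=
  ∀ ⦃s t : ℝ⦄, 0 ≤ s → 0 ≤ t → dist (γ s) (γ t) = |s - t|

theorem IsGeodRay.dist_of_le {γ : ℝ → T} (h : IsGeodRay γ) {s t : ℝ} (hs : 0 ≤ s)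
    (hst : s ≤ t) : dist (γ s) (γ t) = t - s := by
  rw [h hs (hs.trans hst), abs_sub_comm, abs_of_nonneg (by linarith)]

theorem IsGeodRay.dist_zero {γ : ℝ → T} (h : IsGeodRay γ) {t : ℝ} (ht : 0 ≤ t) :
    dist (γ 0) (γ t) = t := by
  rw [h.dist_of_le le_rfl ht, sub_zero]

theorem IsGeodRay.shift {γ : ℝ → T} (h : IsGeodRay γ) {a : ℝ} (ha : 0 ≤ a) :
    IsGeodRay fun t => γ (a + t) := by
  intro s t hs ht
  rw [h (by linarith) (by linarith)]
  congr 1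
  ring

theorem IsGeodRay.isRayFrom {γ : ℝ → T} (h : IsGeodRay γ) :
    IsRayFrom (γ 0) (γ '' Set.Ici 0) := by
  refine ⟨fun t => γ t, Isometry.of_dist_eq fun s t => ?_, by simp, ?_⟩
  · rw [h s.coe_nonneg t.coe_nonneg, NNReal.dist_eq]
  · ext p
    constructor
    · rintro ⟨t, rfl⟩
      exact ⟨t, t.2, rfl⟩
    · rintro ⟨t, ht, rfl⟩
      exact ⟨⟨t, ht⟩, rfl⟩

theorem IsRayFrom.exists_isGeodRay {x : T} {R : Set T} (h : IsRayFrom x R) :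
    ∃ γ : ℝ → T, IsGeodRay γ ∧ γ 0 = x ∧ γ '' Set.Ici 0 = R := by
  obtain ⟨γ, hγ, h0, rfl⟩ := h
  refine ⟨fun t => γ t.toNNReal, fun s t hs ht => ?_, by simpa using h0, ?_⟩
  · rw [hγ.dist_eq, NNReal.dist_eq, Real.coe_toNNReal _ hs, Real.coe_toNNReal _ ht]
  · ext p
    constructor
    · rintro ⟨t, -, rfl⟩
      exact ⟨_, rfl⟩
    · rintro ⟨t, rfl⟩
      exact ⟨t, t.2, by simp⟩

theorem IsRay.exists_isGeodRay {R : Set T} (h : IsRay R) :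
    ∃ γ : ℝ → T, IsGeodRay γ ∧ γ '' Set.Ici 0 = R := by
  obtain ⟨γ, hγ, hR⟩ := h
  obtain ⟨γ', h', -, h''⟩ := IsRayFrom.exists_isGeodRay ⟨γ, hγ, rfl, hR⟩
  exact ⟨γ', h', h''⟩

variable [IsRTree T]

/-- `γ` is a geodesic ray which represents the end `e`. -/
def Conv (γ : ℝ → T) (e : Ends T) : Prop :=
  IsGeodRay γ ∧ ∃ hR : IsRay (γ '' Set.Ici 0), Quotient.mk (raySetoid T) ⟨_, hR⟩ = e

theorem IsGeodRay.exists_conv {γ : ℝ → T} (h : IsGeodRay γ) : ∃ e, Conv γ e :=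
  ⟨_, h, h.isRayFrom.isRay, rfl⟩

theorem exists_conv (e : Ends T) : ∃ γ : ℝ → T, Conv γ e := by
  induction e using Quotient.inductionOn with
  | h R =>
    obtain ⟨R, hR⟩ := R
    obtain ⟨γ, hγ, h⟩ := hR.exists_isGeodRay
    subst h
    exact ⟨γ, hγ, hR, rfl⟩

theorem Conv.eq_of_subset {γ γ' : ℝ → T} {e e' : Ends T} (h : Conv γ e) (h' : Conv γ' e')
    {ρ : ℝ → T} (hρ : IsGeodRay ρ) (h1 : ρ '' Set.Ici 0 ⊆ γ '' Set.Ici 0)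
    (h2 : ρ '' Set.Ici 0 ⊆ γ' '' Set.Ici 0) : e = e' := by
  obtain ⟨-, hR, rfl⟩ := h
  obtain ⟨-, hR', rfl⟩ := h'
  exact Quotient.sound (hR.inter_of_subset hR' hρ.isRayFrom.isRay h1 h2)

theorem Conv.eq_of_shift {γ γ' : ℝ → T} {e e' : Ends T} (h : Conv γ e) (h' : Conv γ' e')
    {a b : ℝ} (ha : 0 ≤ a) (hb : 0 ≤ b) (hab : ∀ t, 0 ≤ t → γ (a + t) = γ' (b + t)) :
    e = e' := by
  refine h.eq_of_subset h' (h.1.shift ha) ?_ ?_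
  · rintro _ ⟨t, ht, rfl⟩
    exact ⟨a + t, add_nonneg ha ht, rfl⟩
  · rintro _ ⟨t, ht, rfl⟩
    exact ⟨b + t, add_nonneg hb ht, (hab t ht).symm⟩

theorem Conv.unique {γ : ℝ → T} {e e' : Ends T} (h : Conv γ e) (h' : Conv γ e') : e = e' :=
  h.eq_of_shift h' le_rfl le_rfl fun _ _ => rfl

theorem Conv.congr {γ γ' : ℝ → T} {e : Ends T} (h : Conv γ e) (hγ : IsGeodRay γ')
    {a b : ℝ} (ha : 0 ≤ a) (hb : 0 ≤ b) (hab : ∀ t, 0 ≤ t → γ (a + t) = γ' (b + t)) :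
    Conv γ' e := by
  obtain ⟨e', h'⟩ := hγ.exists_conv
  rwa [h.eq_of_shift h' ha hb hab]

theorem Conv.shift {γ : ℝ → T} {e : Ends T} (h : Conv γ e) {a : ℝ} (ha : 0 ≤ a) :
    Conv (fun t => γ (a + t)) e :=
  h.congr (h.1.shift ha) ha le_rfl fun t _ => by simp

/-- Rays representing the same end meet arbitrarily far out. -/
theorem Conv.exists_eq {γ γ' : ℝ → T} {e : Ends T} (h : Conv γ e) (h' : Conv γ' e) (N : ℝ) :
    ∃ t t', N ≤ t ∧ N ≤ t' ∧ 0 ≤ t ∧ 0 ≤ t' ∧ γ t = γ' t' := by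
  obtain ⟨hγ, hR, rfl⟩ := h
  obtain ⟨hγ', hR', he⟩ := h'
  have hi : IsRay (γ' '' Set.Ici 0 ∩ γ '' Set.Ici 0) := Quotient.exact he
  obtain ⟨ρ, hρ, hi⟩ := hi.exists_isGeodRay
  set s := max 0 (N + max (dist (ρ 0) (γ 0)) (dist (ρ 0) (γ' 0))) with hs
  have s0 : 0 ≤ s := le_max_left _ _
  have s1 : N + max (dist (ρ 0) (γ 0)) (dist (ρ 0) (γ' 0)) ≤ s := le_max_right _ _
  have s2 := le_max_left (dist (ρ 0) (γ 0)) (dist (ρ 0) (γ' 0))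
  have s3 := le_max_right (dist (ρ 0) (γ 0)) (dist (ρ 0) (γ' 0))
  have hm : ρ s ∈ γ' '' Set.Ici 0 ∩ γ '' Set.Ici 0 := hi ▸ ⟨s, s0, rfl⟩
  obtain ⟨⟨t', ht', e'⟩, ⟨t, ht, e⟩⟩ := hm
  have d0 := hρ.dist_zero s0
  have d1 := hγ.dist_zero ht
  have d2 := hγ'.dist_zero ht'
  rw [e] at d1
  rw [e'] at d2
  exact ⟨t, t', by linarith [dist_triangle (ρ 0) (γ 0) (ρ s)],
    by linarith [dist_triangle (ρ 0) (γ' 0) (ρ s)], ht, ht', e.trans e'.symm⟩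

/-- The Busemann function of a geodesic ray. -/
noncomputable def rayBus (γ : ℝ → T) (x : T) : ℝ :=
  dist x (γ (dist x (γ 0))) - dist x (γ 0)

/-- The function `t ↦ dist x (γ t) - t` is already constant from `dist x (γ 0)` on, which is why
`rayBus` needs no limit. By the four point condition, `γ s` with `s = dist x (γ 0)` either equals
`x` or lies between `x` and `γ t`. -/
theorem IsGeodRay.rayBus_eq {γ : ℝ → T} (h : IsGeodRay γ) (x : T) {t : ℝ}
    (ht : dist x (γ 0) ≤ t) : dist x (γ t) = t + rayBus γ x := by
  set s := dist x (γ 0) with hs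
  have s0 : 0 ≤ s := dist_nonneg
  have e : rayBus γ x = dist x (γ s) - s := rfl
  have d1 := h.dist_of_le s0 ht
  have d2 := h.dist_zero s0
  have d3 := h.dist_zero (s0.trans ht)
  have t1 := dist_triangle x (γ s) (γ t)
  have f := four_point x (γ s) (γ 0) (γ t)
  rw [dist_comm (γ s) (γ 0), d1, d2, d3, ← hs] at f
  rcases le_max_iff.1 f with f | f
  · have hz : dist x (γ s) = 0 := le_antisymm (by linarith) dist_nonneg
    have hx := dist_eq_zero.1 hz
    rw [← hx] at d1
    rw [e, hz, d1]
    ring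
  · rw [e]
    linarith

/-- A chosen representative of an end. -/
noncomputable def Ends.rep (e : Ends T) : ℝ → T := (exists_conv e).choose

theorem Ends.conv_rep (e : Ends T) : Conv e.rep e := (exists_conv e).choose_spec

/-- The Busemann cocycle of an end, negative if `x` is closer to the end than `y`. -/
noncomputable def bus (e : Ends T) (x y : T) : ℝ := rayBus e.rep x - rayBus e.rep y

/-- Any two rays to `e` share points arbitrarily far out; measuring from such a point gives the same
difference for both. -/
theorem Conv.bus_eq {γ : ℝ → T} {e : Ends T} (h : Conv γ e) (x y : T) :
    bus e x y = rayBus γ x - rayBus γ y := by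
  set ρ := e.rep with hρ
  have hc : Conv ρ e := e.conv_rep
  set N := max (max (dist x (γ 0)) (dist y (γ 0))) (max (dist x (ρ 0)) (dist y (ρ 0))) with hN
  obtain ⟨t, t', h1, h2, -, -, he⟩ := h.exists_eq hc N
  have n1 : dist x (γ 0) ≤ N := (le_max_left _ _).trans (le_max_left _ _)
  have n2 : dist y (γ 0) ≤ N := (le_max_right _ _).trans (le_max_left _ _)
  have n3 : dist x (ρ 0) ≤ N := (le_max_left _ _).trans (le_max_right _ _)
  have n4 : dist y (ρ 0) ≤ N := (le_max_right _ _).trans (le_max_right _ _)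
  have e1 := h.1.rayBus_eq x (n1.trans h1)
  have e2 := h.1.rayBus_eq y (n2.trans h1)
  have e3 := hc.1.rayBus_eq x (n3.trans h2)
  have e4 := hc.1.rayBus_eq y (n4.trans h2)
  rw [← he] at e3 e4
  show rayBus ρ x - rayBus ρ y = _
  linarith

theorem Conv.bus_eq_dist_sub_dist {γ : ℝ → T} {e : Ends T} (h : Conv γ e) {x y : T} {t : ℝ}
    (hx : dist x (γ 0) ≤ t) (hy : dist y (γ 0) ≤ t) :
    bus e x y = dist x (γ t) - dist y (γ t) := by
  rw [h.bus_eq, h.1.rayBus_eq x hx, h.1.rayBus_eq y hy]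
  ring

theorem bus_add (e : Ends T) (x y z : T) : bus e x y + bus e y z = bus e x z := by
  simp only [bus]
  ring

@[simp] theorem bus_self (e : Ends T) (x : T) : bus e x x = 0 := by
  simp only [bus]
  ring

theorem bus_neg (e : Ends T) (x y : T) : -bus e x y = bus e y x := by
  simp only [bus]
  ring

theorem bus_le_dist (e : Ends T) (x y : T) : bus e x y ≤ dist x y := by
  have h := e.conv_rep
  rw [h.bus_eq_dist_sub_dist (le_max_left _ (dist y (e.rep 0))) (le_max_right _ _)]
  linarith [dist_triangle x y (e.rep (max (dist x (e.rep 0)) (dist y (e.rep 0))))]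

theorem neg_dist_le_bus (e : Ends T) (x y : T) : -dist x y ≤ bus e x y := by
  rw [← bus_neg e y x, dist_comm]
  exact neg_le_neg (bus_le_dist e y x)

theorem Conv.bus_ray {γ : ℝ → T} {e : Ends T} (h : Conv γ e) {t : ℝ} (ht : 0 ≤ t) :
    bus e (γ t) (γ 0) = -t := by
  have d := h.1.dist_zero ht
  rw [h.bus_eq_dist_sub_dist (t := t) (by rw [dist_comm, d]) (by simpa using ht), dist_self, d]
  ring

/-- Any point is joined to any end by a ray. -/
theorem exists_conv_from (x : T) (e : Ends T) : ∃ γ : ℝ → T, γ 0 = x ∧ Conv γ e := by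
  obtain ⟨ρ, hρ⟩ := exists_conv e
  set s := dist x (ρ 0) with hs
  have s0 : 0 ≤ s := dist_nonneg
  set D := dist x (ρ s) with hD
  have D0 : 0 ≤ D := dist_nonneg
  -- From time `s` on, `ρ` moves away from `x` at unit speed, so the segment from `x` to `ρ s`
  -- followed by the rest of `ρ` is a geodesic ray.
  have key : ∀ t, s ≤ t → dist x (ρ t) = D + (t - s) := by
    intro t ht
    have e1 := hρ.1.rayBus_eq x ht
    have e2 := hρ.1.rayBus_eq x (le_refl s)
    linarith
  obtain ⟨S, ⟨σ, σ0, σ1, σd, -⟩, -⟩ := IsRTree.existsUnique_segment x (ρ s)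
  rw [← hD] at σ1 σd
  have hσ : ∀ u, 0 ≤ u → u ≤ D → dist x (σ u) = u := by
    intro u h0 h1
    have := σd 0 ⟨le_rfl, D0⟩ u ⟨h0, h1⟩
    rwa [σ0, zero_sub, abs_neg, abs_of_nonneg h0] at this
  have hσ' : ∀ u, 0 ≤ u → u ≤ D → dist (σ u) (ρ s) = D - u := by
    intro u h0 h1
    have := σd u ⟨h0, h1⟩ D ⟨D0, le_rfl⟩
    rwa [σ1, abs_sub_comm, abs_of_nonneg (by linarith)] at this
  have hmix : ∀ u v, 0 ≤ u → u ≤ D → D ≤ v → dist (σ u) (ρ (s + v - D)) = v - u := by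
    intro u v h0 h1 h2
    have e1 := key (s + v - D) (by linarith)
    have e2 := hρ.1.dist_of_le s0 (show s ≤ s + v - D by linarith)
    linarith [dist_triangle x (σ u) (ρ (s + v - D)), hσ u h0 h1, hσ' u h0 h1,
      dist_triangle (σ u) (ρ s) (ρ (s + v - D))]
  have hray : IsGeodRay fun u => if u ≤ D then σ u else ρ (s + u - D) := by
    intro u v hu hv
    dsimp only
    split_ifs with h1 h2 h2
    · exact σd u ⟨hu, h1⟩ v ⟨hv, h2⟩
    · rw [hmix u v hu h1 (le_of_not_ge h2), abs_sub_comm, abs_of_nonneg (by linarith)]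
    · rw [dist_comm, hmix v u hv h2 (le_of_not_ge h1), abs_of_nonneg (by linarith)]
    · rw [hρ.1 (by linarith) (by linarith)]
      congr 1
      ring
  refine ⟨_, ?_, hρ.congr hray s0 D0 fun t ht => ?_⟩
  · simp [D0, σ0]
  · split_ifs with h
    · have : t = 0 := by linarith
      rw [this, add_zero, add_zero, σ1]
    · congr 1
      ring

/-- Let `ρ` be the ray from `γ 0` to `e`. Evaluated at `ρ t`, the Busemann value of `γ t` is `dist
(γ t) (ρ t) - t`, so the hypothesis forces the two rays to agree. Thus Busemann cocycles separate
ends. -/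
theorem conv_of_bus {γ : ℝ → T} (hγ : IsGeodRay γ) {e : Ends T}
    (h : ∀ t, 0 ≤ t → bus e (γ t) (γ 0) = -t) : Conv γ e := by
  obtain ⟨ρ, h0, hρ⟩ := exists_conv_from (γ 0) e
  refine hρ.congr hγ le_rfl le_rfl fun t ht => ?_
  have d := hγ.dist_zero ht
  have := h t ht
  rw [hρ.bus_eq_dist_sub_dist (t := t) (by rw [h0, dist_comm, d]) (by simpa [h0] using ht),
    ← h0, hρ.1.dist_zero ht] at this
  rw [zero_add]
  exact (dist_eq_zero.1 (by linarith)).symm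

theorem Conv.eqOn {γ γ' : ℝ → T} {e : Ends T} (h : Conv γ e) (h' : Conv γ' e)
    (h0 : γ 0 = γ' 0) {t : ℝ} (ht : 0 ≤ t) : γ t = γ' t := by
  have d := h.1.dist_zero ht
  have := h.bus_ray ht
  rw [h'.bus_eq_dist_sub_dist (t := t) (by rw [← h0, dist_comm, d]) (by simpa [h0] using ht),
    h0, h'.1.dist_zero ht] at this
  exact dist_eq_zero.1 (by linarith)

theorem Ends.ext_bus {e e' : Ends T} (h : ∀ x y, bus e x y = bus e' x y) : e = e' := by
  obtain ⟨γ, hγ⟩ := exists_conv e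
  exact hγ.unique (conv_of_bus hγ.1 fun t ht => by rw [← h, hγ.bus_ray ht])

end Rays

/-! ### Gromov products of ends and lines -/

section Gromov

variable {T : Type*} [MetricSpace T] [IsRTree T]

/-- The Gromov product of two ends with respect to `x`; for distinct ends this is the distance
of `x` from the line joining them. -/
noncomputable def gp (a b : Ends T) (x : T) : ℝ := ⨆ y, (bus a x y + bus b x y) / 2

theorem gp_comm (a b : Ends T) (x : T) : gp a b x = gp b a x := by
  simp only [gp, add_comm]

/-- Distinct ends are joined by a line. -/
theorem exists_apex {a b : Ends T} (hab : a ≠ b) (x : T) {γ γ' : ℝ → T} (h0 : γ 0 = x)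
    (h0' : γ' 0 = x) (h : Conv γ a) (h' : Conv γ' b) :
    ∃ s, 0 ≤ s ∧ γ s = γ' s ∧
      ∀ u v, 0 ≤ u → 0 ≤ v → dist (γ (s + u)) (γ' (s + v)) = u + v := by
  obtain ⟨t, ht, hne⟩ : ∃ t, 0 ≤ t ∧ γ t ≠ γ' t := by
    by_contra! hcon
    exact hab (h.eq_of_shift h' le_rfl le_rfl fun t ht => by simpa using hcon t ht)
  have dx : ∀ t, 0 ≤ t → dist x (γ t) = t := fun t ht => h0 ▸ h.1.dist_zero ht
  have dx' : ∀ t, 0 ≤ t → dist x (γ' t) = t := fun t ht => h0' ▸ h'.1.dist_zero ht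
  have hpos : 0 < dist (γ t) (γ' t) := dist_pos.2 hne
  have hle : dist (γ t) (γ' t) ≤ 2 * t := by
    linarith [dist_triangle (γ t) x (γ' t), dx t ht, dx' t ht, dist_comm x (γ t)]
  -- The value `s` is the Gromov product of `γ t` and `γ' t` seen from `x`, where the rays separate.
  set s := t - dist (γ t) (γ' t) / 2 with hs
  have s0 : 0 ≤ s := by linarith
  have hst : s ≤ t := by linarith
  have hs' : γ s = γ' s := by
    have e1 := h.1.dist_of_le s0 hst
    have e2 := h'.1.dist_of_le s0 hst
    refine eq_of_le_gromov (x := x) (y := γ t) (z := γ' t) ?_ ?_ ?_ ?_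
    · rw [e1, dx s s0, dx t ht]; ring
    · rw [e2, dx' s s0, dx' t ht]; ring
    · rw [dx s s0, dx' s s0]
    · rw [dx s s0, dx t ht, dx' t ht]; linarith
  -- After separating, the rays diverge at full speed: a smaller distance at time `M` would violate
  -- hyperbolicity.
  have far : ∀ M, t ≤ M → 2 * M - 2 * s ≤ dist (γ M) (γ' M) := by
    intro M hM
    have M0 := ht.trans hM
    have g1 := gromov_min_le x (γ t) (γ M) (γ' t)
    have g2 := gromov_min_le x (γ M) (γ' M) (γ' t)
    have e1 := h.1.dist_of_le ht hM
    have e2 := h'.1.dist_of_le ht hM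
    rw [dist_comm] at e2
    rw [dx _ ht, dx _ M0, dx' _ ht, e1] at g1
    rw [dx _ M0, dx' _ M0, dx' _ ht, e2] at g2
    rcases min_le_iff.1 g1 with g1 | g1
    · linarith
    · rcases min_le_iff.1 g2 with g2 | g2 <;> linarith
  refine ⟨s, s0, hs', fun u v hu hv => le_antisymm ?_ ?_⟩
  · have e1 := h.1.dist_of_le s0 (show s ≤ s + u by linarith)
    have e2 := h'.1.dist_of_le s0 (show s ≤ s + v by linarith)
    rw [← hs'] at e2
    linarith [dist_triangle (γ (s + u)) (γ s) (γ' (s + v)), dist_comm (γ s) (γ (s + u))]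
  · set M := max t (s + max u v) with hM
    have m1 : t ≤ M := le_max_left _ _
    have m2 : s + max u v ≤ M := le_max_right _ _
    have m3 := le_max_left u v
    have m4 := le_max_right u v
    have e1 := h.1.dist_of_le (show 0 ≤ s + u by linarith) (show s + u ≤ M by linarith)
    have e2 := h'.1.dist_of_le (show 0 ≤ s + v by linarith) (show s + v ≤ M by linarith)
    linarith [far M m1, dist_triangle (γ M) (γ (s + u)) (γ' M),
      dist_triangle (γ (s + u)) (γ' (s + v)) (γ' M), dist_comm (γ M) (γ (s + u))]

theorem bus_add_bus_nonneg {a b : Ends T} {γ γ' : ℝ → T} (h : Conv γ a) (h' : Conv γ' b)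
    (h0 : γ 0 = γ' 0) (hd : ∀ u v, 0 ≤ u → 0 ≤ v → dist (γ u) (γ' v) = u + v) (y : T) :
    0 ≤ bus a y (γ 0) + bus b y (γ 0) := by
  have d0 : 0 ≤ dist y (γ 0) := dist_nonneg
  rw [h.bus_eq_dist_sub_dist (t := dist y (γ 0)) le_rfl (by simp),
    h'.bus_eq_dist_sub_dist (t := dist y (γ 0)) (by rw [h0]) (by rw [h0]; simp)]
  have e1 := h.1.dist_zero d0
  have e2 := h'.1.dist_zero d0
  rw [← h0] at e2
  have e3 := hd _ _ d0 d0
  linarith [dist_triangle (γ (dist y (γ 0))) y (γ' (dist y (γ 0))),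
    dist_comm y (γ (dist y (γ 0)))]

/-- A point `z` of the line minimises `bus a + bus b`, so the supremum is attained there. For `a =
b` the supremum is over an unbounded set and takes the default value `0`; this is why Gromov
products are handled for distinct ends. -/
theorem gp_eq_of_nonneg {a b : Ends T} {z : T} (hz : ∀ y, 0 ≤ bus a y z + bus b y z) (x : T) :
    gp a b x = (bus a x z + bus b x z) / 2 := by
  have hb : ∀ y, (bus a x y + bus b x y) / 2 ≤ (bus a x z + bus b x z) / 2 := by
    intro y
    linarith [hz y, bus_add a x y z, bus_add b x y z]
  have : Nonempty T := ⟨x⟩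
  exact le_antisymm (ciSup_le hb) (le_ciSup (f := fun y => (bus a x y + bus b x y) / 2)
    ⟨_, Set.forall_mem_range.2 hb⟩ z)

/-- The structure of the line joining two distinct ends. -/
theorem exists_line {a b : Ends T} (hab : a ≠ b) (x : T) :
    ∃ γ γ' : ℝ → T, Conv γ a ∧ Conv γ' b ∧ γ 0 = γ' 0 ∧
      (∀ u v, 0 ≤ u → 0 ≤ v → dist (γ u) (γ' v) = u + v) ∧
      (∀ y, gp a b y = (bus a y (γ 0) + bus b y (γ 0)) / 2) ∧
      dist x (γ 0) = gp a b x := by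
  obtain ⟨γ, h0, h⟩ := exists_conv_from x a
  obtain ⟨γ', h0', h'⟩ := exists_conv_from x b
  obtain ⟨s, s0, hs, hd⟩ := exists_apex hab x h0 h0' h h'
  have hgp : ∀ y, gp a b y = (bus a y (γ (s + 0)) + bus b y (γ (s + 0))) / 2 :=
    gp_eq_of_nonneg (bus_add_bus_nonneg (h.shift s0) (h'.shift s0) (by simpa using hs) hd)
  refine ⟨_, _, h.shift s0, h'.shift s0, by simpa using hs, hd, hgp, ?_⟩
  rw [hgp, add_zero]
  have e1 := h.bus_ray s0
  have e2 := h'.bus_ray s0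
  rw [h0] at e1
  rw [h0', ← hs] at e2
  rw [← bus_neg a, ← bus_neg b, e1, e2, ← h0, h.1.dist_zero s0]
  ring

/-- This change of base point carries most later computations. Both products are half-sums of
Busemann values relative to the same point of the line. -/
theorem gp_sub_gp {a b : Ends T} (hab : a ≠ b) (x y : T) :
    2 * (gp a b x - gp a b y) = bus a x y + bus b x y := by
  obtain ⟨γ, γ', -, -, -, -, h, -⟩ := exists_line hab x
  rw [h x, h y]
  linarith [bus_add a x y (γ 0), bus_add b x y (γ 0)]

theorem gp_nonneg {a b : Ends T} (hab : a ≠ b) (x : T) : 0 ≤ gp a b x := by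
  obtain ⟨γ, γ', -, -, -, -, -, h⟩ := exists_line hab x
  rw [← h]
  exact dist_nonneg

/-- Rays from `x` coincide up to the Gromov product. -/
theorem Conv.eq_iff_le_gp {a b : Ends T} (hab : a ≠ b) {γ γ' : ℝ → T} (h : Conv γ a)
    (h' : Conv γ' b) (h0 : γ 0 = γ' 0) {t : ℝ} (ht : 0 ≤ t) :
    γ t = γ' t ↔ t ≤ gp a b (γ 0) := by
  obtain ⟨s, s0, hs, hd⟩ := exists_apex hab (γ 0) rfl h0.symm h h'
  have hgp := gp_eq_of_nonneg
    (bus_add_bus_nonneg (h.shift s0) (h'.shift s0) (by simpa using hs) hd) (γ 0)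
  have e1 := h.bus_ray s0
  have e2 := h'.bus_ray s0
  rw [← h0, ← hs] at e2
  have hg : gp a b (γ 0) = s := by
    rw [hgp, add_zero, ← bus_neg a, ← bus_neg b, e1, e2]
    ring
  rw [hg]
  constructor
  · intro hE
    by_contra! hlt
    have := hd (t - s) (t - s) (by linarith) (by linarith)
    rw [add_sub_cancel, hE, dist_self] at this
    linarith
  · intro hle
    have d1 := h.1.dist_zero ht
    have d2 := h'.1.dist_zero ht
    have d3 := h.1.dist_zero s0
    have d4 := h.1.dist_of_le ht hle
    have d5 := h'.1.dist_of_le ht hle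
    rw [← h0] at d2
    rw [← hs] at d5
    exact eq_of_between (x := γ 0) (y := γ s) (by linarith) (by linarith) (by linarith)

/-- The ultrametric inequality for ends. -/
theorem gp_min_le {a b e : Ends T} (hab : a ≠ b) (hae : a ≠ e) (heb : e ≠ b) (x : T) :
    min (gp a e x) (gp e b x) ≤ gp a b x := by
  obtain ⟨γ, rfl, h⟩ := exists_conv_from x a
  obtain ⟨γ', h0', h'⟩ := exists_conv_from (γ 0) b
  obtain ⟨ρ, h0, hρ⟩ := exists_conv_from (γ 0) e
  set m := min (gp a e (γ 0)) (gp e b (γ 0)) with hm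
  have m0 : 0 ≤ m := le_min (gp_nonneg hae _) (gp_nonneg heb _)
  rw [← h.eq_iff_le_gp hab h' h0'.symm m0, (h.eq_iff_le_gp hae hρ h0.symm m0).2 (min_le_left _ _)]
  exact (hρ.eq_iff_le_gp heb h' (h0.trans h0'.symm) m0).2 (h0.symm ▸ min_le_right _ _)

/-- Seen from a point of the line joining `a` and `b`, the end `e` cannot lie in the directions of
both. -/
theorem gp_eq_zero_or {a b e : Ends T} (hab : a ≠ b) (hae : a ≠ e) (heb : e ≠ b) {x : T}
    (hx : gp a b x = 0) : gp a e x = 0 ∨ gp e b x = 0 := by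
  have h := gp_min_le hab hae heb x
  rw [hx] at h
  exact (min_le_iff.1 h).imp (fun h => le_antisymm h (gp_nonneg hae x))
    fun h => le_antisymm h (gp_nonneg heb x)

/-- Points on the line joining two ends can be prescribed by their position. -/
theorem exists_gp_eq_zero {a b : Ends T} (hab : a ≠ b) (z : T) (t : ℝ) :
    ∃ x, gp a b x = 0 ∧ bus a x z = t := by
  obtain ⟨γ, γ', h, h', h0, hd, hg, -⟩ := exists_line hab z
  have key : ∀ r : ℝ, ∃ x, gp a b x = 0 ∧ bus a x (γ 0) = r := by
    intro r
    have hr := neg_le_abs r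
    have hr' := le_abs_self r
    -- Negative positions lie on the half-line towards `a`, positive ones on the half-line towards
    -- `b`.
    rcases le_total r 0 with hr0 | hr0
    · have r1 : 0 ≤ -r := by linarith
      have e1 := h.bus_ray r1
      refine ⟨γ (-r), ?_, by linarith⟩
      have d0 := h'.1.dist_zero r1
      rw [hg, e1, h'.bus_eq_dist_sub_dist (t := -r)
        (by rw [← h0, dist_comm, h.1.dist_zero r1]) (by rw [h0]; simpa using r1), h0, d0,
        hd _ _ r1 r1]
      ring
    · have e1 := h'.bus_ray hr0
      rw [← h0] at e1
      have e2 : bus a (γ' r) (γ 0) = r := by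
        rw [h.bus_eq_dist_sub_dist (t := r) (by rw [h0, dist_comm, h'.1.dist_zero hr0])
          (by simpa using hr0), h.1.dist_zero hr0, dist_comm, hd _ _ hr0 hr0]
        ring
      refine ⟨γ' r, ?_, e2⟩
      rw [hg, e1, e2]
      ring
  obtain ⟨x, hx, hx'⟩ := key (t + bus a z (γ 0))
  exact ⟨x, hx, by linarith [bus_add a x z (γ 0)]⟩

/-- On the line joining two ends, the distance is given by the Busemann function. -/
theorem dist_eq_abs_bus {a b : Ends T} (hab : a ≠ b) {x y : T} (hx : gp a b x = 0)
    (hy : gp a b y = 0) : dist x y = |bus a x y| := by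
  have hsum := gp_sub_gp hab x y
  rw [hx, hy] at hsum
  refine le_antisymm ?_ (abs_le.2 ⟨neg_dist_le_bus a x y, bus_le_dist a x y⟩)
  obtain ⟨γ, rfl, h⟩ := exists_conv_from x a
  obtain ⟨γ', h0', h'⟩ := exists_conv_from (γ 0) b
  obtain ⟨s, s0, hs, hd⟩ := exists_apex hab (γ 0) rfl h0' h h'
  -- Since `x` lies on the line, the rays from `x` to `a` and `b` separate at `x` itself.
  have hs0 : s ≤ 0 := hx ▸ (h.eq_iff_le_gp hab h' h0'.symm s0).1 hs
  obtain rfl : s = 0 := le_antisymm hs0 s0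
  set M := dist (γ 0) y with hM
  have M0 : 0 ≤ M := dist_nonneg
  have e1 := h.bus_eq_dist_sub_dist (t := M) (x := γ 0) (y := y) (by simpa using M0)
    (by rw [dist_comm])
  have e2 := h'.bus_eq_dist_sub_dist (t := M) (x := γ 0) (y := y) (by rw [h0']; simpa using M0)
    (by rw [h0', dist_comm])
  have e3 := hd M M M0 M0
  have d1 := h.1.dist_zero M0
  have d2 := h'.1.dist_zero M0
  rw [zero_add] at e3
  rw [h0'] at d2
  have f := four_point (γ 0) y (γ M) (γ' M)
  have f1 := le_abs_self (bus a (γ 0) y)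
  have f2 := neg_le_abs (bus a (γ 0) y)
  rcases le_max_iff.1 f with f | f <;> linarith

theorem eq_of_gp_eq_zero {a b : Ends T} (hab : a ≠ b) {x y : T} (hx : gp a b x = 0)
    (hy : gp a b y = 0) (h : bus a x y = 0) : x = y := by
  have := dist_eq_abs_bus hab hx hy
  rw [h, abs_zero] at this
  exact dist_eq_zero.1 this

/-- The centre of a triple of ends. -/
theorem exists_center {a b e : Ends T} (hab : a ≠ b) (hae : a ≠ e) (heb : e ≠ b) (z : T) :
    ∃ x, gp a b x = 0 ∧ gp a e x = 0 ∧ gp e b x = 0 := by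
  obtain ⟨y, hy, -⟩ := exists_gp_eq_zero hab z 0
  -- The position is chosen so that `gp a e x = gp e b x`; one of the two vanishes on the line,
  -- hence both do.
  obtain ⟨x, hx, ht⟩ := exists_gp_eq_zero hab y (gp e b y - gp a e y)
  have e1 := gp_sub_gp hae x y
  have e2 := gp_sub_gp heb x y
  have e3 := gp_sub_gp hab x y
  rw [hx, hy] at e3
  refine ⟨x, hx, ?_⟩
  rcases gp_eq_zero_or hab hae heb hx with h | h <;> constructor <;> linarith

theorem center_unique {a b e : Ends T} (hab : a ≠ b) (hae : a ≠ e) (heb : e ≠ b) {x y : T}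
    (h1 : gp a b x = 0) (h2 : gp a e x = 0) (h3 : gp e b x = 0)
    (h1' : gp a b y = 0) (h2' : gp a e y = 0) (h3' : gp e b y = 0) : x = y := by
  refine eq_of_gp_eq_zero hab h1 h1' ?_
  have e1 := gp_sub_gp hae x y
  have e2 := gp_sub_gp heb x y
  have e3 := gp_sub_gp hab x y
  linarith

/-- For ends near `a` the Busemann functions near `x` agree. -/
theorem bus_eq_of_le_gp {a a' : Ends T} (h : a ≠ a') {x z : T} (hz : dist z x ≤ gp a a' x) :
    bus a' z x = bus a z x := by
  obtain ⟨γ, rfl, hγ⟩ := exists_conv_from x a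
  obtain ⟨γ', h0', hγ'⟩ := exists_conv_from (γ 0) a'
  have e := (hγ.eq_iff_le_gp h hγ' h0'.symm dist_nonneg).2 hz
  rw [hγ.bus_eq_dist_sub_dist (t := dist z (γ 0)) le_rfl (by simp),
    hγ'.bus_eq_dist_sub_dist (t := dist z (γ 0)) (by rw [h0']) (by rw [h0']; simp), e]

/-- Of the three sums of Gromov products of four ends, the smallest is attained twice. -/
theorem gp_four_point {a b e d : Ends T} (hab : a ≠ b) (hae : a ≠ e) (had : a ≠ d)
    (hbe : b ≠ e) (hbd : b ≠ d) (hed : e ≠ d) (x : T) :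
    (gp a b x + gp e d x = gp a e x + gp b d x ∧
        gp a b x + gp e d x ≤ gp a d x + gp b e x) ∨
      (gp a b x + gp e d x = gp a d x + gp b e x ∧
        gp a b x + gp e d x ≤ gp a e x + gp b d x) ∨
      (gp a e x + gp b d x = gp a d x + gp b e x ∧
        gp a e x + gp b d x ≤ gp a b x + gp e d x) := by
  -- Moving the base point changes all three sums equally. At the centre of `a`, `b`, `e` they
  -- become `gp e d c`, `gp b d c`, `gp a d c`, of which at most one is nonzero.
  obtain ⟨c, h1, h2, h3⟩ := exists_center hab hae hbe.symm x
  rw [gp_comm] at h3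
  have s1 := gp_sub_gp hab x c
  have s2 := gp_sub_gp hae x c
  have s3 := gp_sub_gp had x c
  have s4 := gp_sub_gp hbe x c
  have s5 := gp_sub_gp hbd x c
  have s6 := gp_sub_gp hed x c
  have z1 := gp_eq_zero_or hab had hbd.symm h1
  have z2 := gp_eq_zero_or hae had hed.symm h2
  have z3 := gp_eq_zero_or hbe hbd hed.symm h3
  rw [gp_comm d b] at z1
  rw [gp_comm d e] at z2 z3
  have p1 := gp_nonneg had c
  have p2 := gp_nonneg hbd c
  have p3 := gp_nonneg hed c
  rcases z1 with z1 | z1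
  · rcases z3 with z3 | z3
    · right; right; constructor <;> linarith
    · right; left; constructor <;> linarith
  · rcases z2 with z2 | z2
    · right; right; constructor <;> linarith
    · left; constructor <;> linarith

end Gromov

/-! ### Leafless trees: points and distances seen from the ends -/

section Leafless

variable {T : Type*} [MetricSpace T] [IsRTree T]

/-- In a leafless tree, any two points lie on a line joining two ends. -/
theorem IsLeafless.exists_ends (h : IsLeafless T) (x y : T) :
    ∃ a b : Ends T, a ≠ b ∧ gp a b x = 0 ∧ gp a b y = 0 ∧ bus a x y = dist x y := by
  obtain ⟨S, hS, -⟩ := IsRTree.existsUnique_segment x y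
  obtain ⟨L, ⟨ℓ, hℓ, rfl⟩, hSL⟩ := h x y S hS
  obtain ⟨s, rfl⟩ := hSL hS.left_mem
  obtain ⟨t, rfl⟩ := hSL hS.right_mem
  have key : ∀ ℓ : ℝ → T, Isometry ℓ → ∀ s t : ℝ, s ≤ t → ∃ a b : Ends T, a ≠ b ∧
      gp a b (ℓ s) = 0 ∧ gp a b (ℓ t) = 0 ∧ bus a (ℓ s) (ℓ t) = dist (ℓ s) (ℓ t) := by
    intro ℓ hℓ s t hst
    have r1 : IsGeodRay fun u => ℓ (s + u) := fun u v _ _ => by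
      rw [hℓ.dist_eq, Real.dist_eq]; congr 1; ring
    have r2 : IsGeodRay fun u => ℓ (s - u) := fun u v _ _ => by
      rw [hℓ.dist_eq, Real.dist_eq, abs_sub_comm]; congr 1; ring
    obtain ⟨a, ha⟩ := r1.exists_conv
    obtain ⟨b, hb⟩ := r2.exists_conv
    have hd : ∀ u v : ℝ, 0 ≤ u → 0 ≤ v → dist (ℓ (s + u)) (ℓ (s - v)) = u + v := by
      intro u v hu hv
      rw [hℓ.dist_eq, Real.dist_eq, abs_of_nonneg (by linarith)]
      ring
    have hg := gp_eq_of_nonneg (bus_add_bus_nonneg ha hb (by simp) hd)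
    have e0 : ∀ u, 0 ≤ u → bus a (ℓ (s + u)) (ℓ s) = -u := fun u hu => by
      simpa using ha.bus_ray hu
    have e1 : ∀ u, 0 ≤ u → bus b (ℓ (s + u)) (ℓ s) = u := fun u hu => by
      have hdu : dist (ℓ (s + u)) (ℓ s) = u := by simpa using hd u 0 hu le_rfl
      rw [hb.bus_eq_dist_sub_dist (t := u) (by simp [hdu]) (by simpa using hu), hd u u hu hu]
      have := hd 0 u le_rfl hu
      rw [add_zero] at this
      rw [this]
      ring
    have hab : a ≠ b := by
      rintro rfl
      linarith [e0 1 zero_le_one, e1 1 zero_le_one]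
    simp only [add_zero] at hg
    refine ⟨a, b, hab, by rw [hg]; simp, ?_, ?_⟩
    · have := e0 (t - s) (by linarith)
      have := e1 (t - s) (by linarith)
      rw [add_sub_cancel] at *
      rw [hg]
      linarith
    · have := e0 (t - s) (by linarith)
      rw [add_sub_cancel] at this
      rw [← bus_neg, this, hℓ.dist_eq, Real.dist_eq, abs_sub_comm, abs_of_nonneg (by linarith)]
      ring
  rcases le_total s t with hst | hst
  · exact key ℓ hℓ s t hst
  · have := key (fun u => ℓ (-u)) (hℓ.comp (IsometryEquiv.neg ℝ).isometry) (-s) (-t)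
      (by linarith)
    simpa using this

theorem IsLeafless.eq_of_bus (h : IsLeafless T) {x y : T} (hb : ∀ e : Ends T, bus e x y = 0) :
    x = y := by
  obtain ⟨a, b, -, -, -, hd⟩ := h.exists_ends x y
  exact dist_eq_zero.1 (hd.symm.trans (hb a))

/-- On any line through `x`, at least one of its two ends is opposite to `e`. -/
theorem IsLeafless.exists_opposite (h : IsLeafless T) (x : T) (e : Ends T) :
    ∃ e', e ≠ e' ∧ gp e e' x = 0 := by
  obtain ⟨a, b, hab, hx, -, -⟩ := h.exists_ends x x
  by_cases hae : a = e
  · exact ⟨b, hae ▸ hab, hae ▸ hx⟩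
  by_cases heb : e = b
  · exact ⟨a, Ne.symm hae, by rw [heb, gp_comm, hx]⟩
  rcases gp_eq_zero_or hab hae heb hx with h | h
  · exact ⟨a, Ne.symm hae, by rw [gp_comm, h]⟩
  · exact ⟨b, heb, h⟩

end Leafless

/-! ### Naturality of Busemann functions and Gromov products -/

section Equivariance

variable {T₁ T₂ : Type*} [MetricSpace T₁] [IsRTree T₁] [MetricSpace T₂] [IsRTree T₂]

theorem IsRescaledIsometry.conv {c : ℝ} {φ : T₁ → T₂} (h : IsRescaledIsometry c φ)
    {γ : ℝ → T₁} {e : Ends T₁} (hγ : Conv γ e) :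
    Conv (fun t => φ (γ (c * t))) (h.endsMap e) := by
  have hc := h.pos
  have hr : IsGeodRay fun t => φ (γ (c * t)) := by
    intro s t hs ht
    have e := h.dist_eq (γ (c * s)) (γ (c * t))
    rw [hγ.1 (by positivity) (by positivity), ← mul_sub, abs_mul, abs_of_pos hc] at e
    exact mul_left_cancel₀ hc.ne' e
  obtain ⟨-, hR, rfl⟩ := hγ
  refine ⟨hr, hr.isRayFrom.isRay, congrArg (Quotient.mk (raySetoid T₂)) (Subtype.ext ?_)⟩
  show (fun t => φ (γ (c * t))) '' Set.Ici 0 = φ '' (γ '' Set.Ici 0)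
  ext p
  constructor
  · rintro ⟨t, ht, rfl⟩
    exact ⟨_, ⟨c * t, mul_nonneg hc.le ht, rfl⟩, rfl⟩
  · rintro ⟨_, ⟨t, ht, rfl⟩, rfl⟩
    refine ⟨c⁻¹ * t, mul_nonneg (inv_nonneg.2 hc.le) ht, ?_⟩
    show φ (γ _) = φ (γ _)
    rw [mul_inv_cancel_left₀ hc.ne']

theorem IsRescaledIsometry.bus_endsMap {c : ℝ} {φ : T₁ → T₂} (h : IsRescaledIsometry c φ)
    (e : Ends T₁) (x y : T₁) : c * bus (h.endsMap e) (φ x) (φ y) = bus e x y := by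
  have hc := h.pos
  obtain ⟨γ, hγ⟩ := exists_conv e
  set N := max (dist x (γ 0)) (dist y (γ 0)) with hN
  have hs : ∀ z, dist z (γ 0) ≤ N → dist (φ z) (φ (γ (c * 0))) ≤ c⁻¹ * N := by
    intro z hz
    rw [mul_zero]
    rw [← h.dist_eq] at hz
    rwa [← div_eq_inv_mul, le_div_iff₀' hc]
  rw [(h.conv hγ).bus_eq_dist_sub_dist (t := c⁻¹ * N) (hs x (le_max_left _ _))
    (hs y (le_max_right _ _)), hγ.bus_eq_dist_sub_dist (t := N) (le_max_left _ _)
    (le_max_right _ _), mul_sub, h.dist_eq, h.dist_eq, mul_inv_cancel_left₀ hc.ne']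

theorem IsRescaledIsometry.gp_endsMap {c : ℝ} {φ : T₁ → T₂} (h : IsRescaledIsometry c φ)
    (a b : Ends T₁) (x : T₁) : c * gp (h.endsMap a) (h.endsMap b) (φ x) = gp a b x := by
  rw [gp, gp, Real.mul_iSup_of_nonneg h.pos.le, ← h.surjective.iSup_comp]
  refine congrArg _ (funext fun y => ?_)
  rw [← h.bus_endsMap a, ← h.bus_endsMap b]
  ring

variable {G T : Type*} [Group G] [MetricSpace T] [IsRTree T] [MulAction G T]
  [IsIsometricSMul G T]

theorem Conv.smul {γ : ℝ → T} {e : Ends T} (h : Conv γ e) (g : G) :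
    Conv (fun t => g • γ t) (g • e) := by
  have := (isRescaledIsometry_smul (T := T) g).conv h
  simp only [one_mul] at this
  exact this

theorem bus_smul (g : G) (e : Ends T) (x y : T) : bus (g • e) (g • x) (g • y) = bus e x y := by
  have := (isRescaledIsometry_smul (T := T) g).bus_endsMap e x y
  rw [one_mul] at this
  exact this

theorem gp_smul (g : G) (a b : Ends T) (x : T) : gp (g • a) (g • b) (g • x) = gp a b x := by
  have := (isRescaledIsometry_smul (T := T) g).gp_endsMap a b x
  rw [one_mul] at this
  exact this

end Equivariance

/-! ### Fixed ends and translation lengths of isometries -/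

section Dynamics

theorem dist_smul_pow {G T : Type*} [MetricSpace T] [Group G] [MulAction G T]
    [IsIsometricSMul G T] (g : G) (x y : T) (m n : ℕ) :
    dist (g ^ m • x) (g ^ (m + n) • y) = dist x (g ^ n • y) := by
  rw [pow_add, mul_smul, dist_smul]

variable {T : Type*} [MetricSpace T] [IsRTree T]

/-- A local criterion for a sequence of points to move away from its origin. -/
theorem dist_add_le_dist_succ {y : ℕ → T} {ℓ : ℝ} (hℓ : 0 < ℓ)
    (h1 : ∀ i, dist (y i) (y (i + 1)) + ℓ ≤ dist (y i) (y (i + 2)))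
    (h2 : ∀ i, dist (y (i + 1)) (y (i + 2)) + ℓ ≤ dist (y i) (y (i + 2))) (n : ℕ) :
    dist (y 0) (y n) + ℓ ≤ dist (y 0) (y (n + 1)) := by
  induction n with
  | zero => linarith [h2 0, dist_triangle (y 0) (y 1) (y 2), dist_self (y 0)]
  | succ n ih =>
    -- The induction hypothesis and `h2` rule out the first alternative; the second, with `h1`, is
    -- the claim.
    have f := four_point (y 0) (y (n + 1)) (y n) (y (n + 2))
    have := h1 n
    have := h2 n
    have := dist_comm (y n) (y (n + 1))
    rcases le_max_iff.1 f with f | f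
    · linarith
    · show _ ≤ dist (y 0) (y (n + 2))
      linarith

variable {G : Type*} [Group G] [MulAction G T] [IsIsometricSMul G T]

/-- The end of the axis of a translation. -/
theorem exists_fixed_end_of_translation {g : G} {y : T} {τ : ℝ} (hτ : 0 < τ)
    (h1 : dist y (g • y) = τ) (h2 : 2 * τ ≤ dist y (g • g • y)) :
    ∃ e : Ends T, g • e = e ∧ bus e (g • y) y = -τ := by
  have hs : ∀ n : ℕ, n * τ ≤ dist y (g ^ n • y) := by
    have step : ∀ n : ℕ, dist y (g ^ n • y) + τ ≤ dist y (g ^ (n + 1) • y) := by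
      intro n
      have := dist_add_le_dist_succ (y := fun i => g ^ i • y) hτ (fun i => ?_) (fun i => ?_) n
      · simpa using this
      · rw [dist_smul_pow, dist_smul_pow, pow_one, pow_two, mul_smul]
        linarith
      · rw [dist_smul_pow, dist_smul_pow g y y (i + 1) 1, pow_one, pow_two, mul_smul]
        linarith
    intro n
    induction n with
    | zero => simp
    | succ n ih =>
      push_cast
      linarith [step n]
  have hu : ∀ n : ℕ, dist y (g ^ n • y) ≤ n * τ := by
    intro n
    induction n with
    | zero => simp
    | succ n ih =>
      have := dist_smul_pow g y y n 1
      rw [pow_one, h1] at this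
      push_cast
      linarith [dist_triangle y (g ^ n • y) (g ^ (n + 1) • y)]
  obtain ⟨S, ⟨σ, σ0, σ1, σd, -⟩, -⟩ := IsRTree.existsUnique_segment y (g • y)
  rw [h1] at σ1 σd
  have hσ : ∀ u, 0 ≤ u → u ≤ τ → dist y (σ u) = u := by
    intro u h0 h1
    have := σd 0 ⟨le_rfl, hτ.le⟩ u ⟨h0, h1⟩
    rwa [σ0, zero_sub, abs_neg, abs_of_nonneg h0] at this
  have hσ' : ∀ u, 0 ≤ u → u ≤ τ → dist (σ u) (g • y) = τ - u := by
    intro u h0 h1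
    have := σd u ⟨h0, h1⟩ τ ⟨hτ.le, le_rfl⟩
    rwa [σ1, abs_sub_comm, abs_of_nonneg (by linarith)] at this
  have hmix : ∀ (u v : ℝ) (k : ℕ), 0 ≤ u → u ≤ τ → 0 ≤ v → v ≤ τ →
      dist (σ u) (g ^ (k + 1) • σ v) = (k + 1) * τ + v - u := by
    intro u v k u0 u1 v0 v1
    refine le_antisymm ?_ ?_
    · have e1 := hσ' u u0 u1
      have e2 := hu k
      have e3 := dist_smul_pow g y y 1 k
      have e4 : dist (g ^ (k + 1) • y) (g ^ (k + 1) • σ v) = v := by rw [dist_smul, hσ v v0 v1]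
      rw [pow_one, add_comm 1 k] at e3
      linarith [dist_triangle (σ u) (g • y) (g ^ (k + 1) • σ v),
        dist_triangle (g • y) (g ^ (k + 1) • y) (g ^ (k + 1) • σ v)]
    · have e1 := hs (k + 2)
      have e2 := hσ u u0 u1
      have e3 : dist (g ^ (k + 1) • σ v) (g ^ (k + 2) • y) = τ - v := by
        rw [pow_succ g (k + 1), mul_smul, dist_smul, hσ' v v0 v1]
      push_cast at e1
      linarith [dist_triangle y (σ u) (g ^ (k + 2) • y),
        dist_triangle (σ u) (g ^ (k + 1) • σ v) (g ^ (k + 2) • y)]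
  -- The translates of the segment from `y` to `g • y` are strung together; `g` shifts the resulting
  -- ray by `τ`.
  set γ : ℝ → T := fun t => g ^ ⌊t / τ⌋₊ • σ (t - ⌊t / τ⌋₊ * τ) with hγ
  have hfl : ∀ t, 0 ≤ t → 0 ≤ t - ⌊t / τ⌋₊ * τ ∧ t - ⌊t / τ⌋₊ * τ ≤ τ := by
    intro t ht
    have e1 := Nat.floor_le (div_nonneg ht hτ.le)
    have e2 := (Nat.lt_floor_add_one (t / τ)).le
    rw [le_div_iff₀ hτ] at e1
    rw [div_le_iff₀ hτ] at e2
    constructor <;> linarith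
  have hmono : ∀ s t, 0 ≤ s → s ≤ t → dist (γ s) (γ t) = t - s := by
    intro s t hs hst
    have ht := hs.trans hst
    obtain ⟨s1, s2⟩ := hfl s hs
    obtain ⟨t1, t2⟩ := hfl t ht
    obtain ⟨k, hk⟩ := Nat.exists_eq_add_of_le
      (Nat.floor_mono (div_le_div_of_nonneg_right hst hτ.le))
    simp only [hγ]
    rcases k with _ | k
    · rw [add_zero] at hk
      rw [hk] at t1 t2 ⊢
      rw [dist_smul, σd _ ⟨s1, s2⟩ _ ⟨t1, t2⟩, abs_sub_comm, abs_of_nonneg (by linarith)]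
      ring
    · rw [hk] at t1 t2 ⊢
      rw [dist_smul_pow, hmix _ _ _ s1 s2 t1 t2]
      push_cast
      ring
  have hray : IsGeodRay γ := by
    intro s t hs ht
    rcases le_total s t with h | h
    · rw [hmono s t hs h, abs_sub_comm, abs_of_nonneg (by linarith)]
    · rw [dist_comm, hmono t s ht h, abs_of_nonneg (by linarith)]
  have hshift : ∀ t, 0 ≤ t → g • γ t = γ (τ + t) := by
    intro t ht
    have e : ⌊(τ + t) / τ⌋₊ = ⌊t / τ⌋₊ + 1 := by
      rw [add_div, div_self hτ.ne', add_comm, Nat.floor_add_one (div_nonneg ht hτ.le)]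
    simp only [hγ]
    rw [e, ← mul_smul, ← pow_succ']
    congr 2
    push_cast
    ring
  obtain ⟨e, he⟩ := hray.exists_conv
  have γ0 : γ 0 = y := by simp [hγ, σ0]
  refine ⟨e, (he.smul g).eq_of_shift he le_rfl hτ.le fun t ht => ?_, ?_⟩
  · simpa using hshift t ht
  · have := hshift 0 le_rfl
    rw [← γ0, this, add_zero, he.bus_ray hτ.le]

/-- An isometry which moves a point further by its square fixes an end. -/
theorem exists_fixed_end_of_lt {g : G} {p : T} (h : dist p (g • p) < dist p (g • g • p)) :
    ∃ e : Ends T, g • e = e := by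
  set D := dist p (g • p) with hD
  set ℓ := dist p (g • g • p) - D with hℓ
  have hℓ0 : 0 < ℓ := by linarith
  have hD' : dist (g • p) (g • g • p) = D := dist_smul _ _ _
  have hℓD : ℓ ≤ D := by linarith [dist_triangle p (g • p) (g • g • p)]
  have h3 : D + 2 * ℓ ≤ dist p (g • g • g • p) := by
    have := dist_add_le_dist_succ (y := fun i => g ^ i • p) hℓ0 (fun i => ?_) (fun i => ?_) 2
    · simp only [pow_succ, pow_zero, one_mul, one_smul, mul_smul] at this
      linarith
    · rw [dist_smul_pow, dist_smul_pow, pow_one, pow_two, mul_smul]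
      linarith
    · rw [dist_smul_pow, dist_smul_pow g p p (i + 1) 1, pow_one, pow_two, mul_smul]
      linarith
  -- The midpoint `m` of `p` and `g • p` lies on the axis, and the translation length is the excess
  -- `ℓ`.
  obtain ⟨m, m1, m2⟩ := exists_between p (g • p) (s := D / 2) (by linarith) (by linarith)
  -- The geodesics from `g • p` to `p` and to `g • g • p` separate at their Gromov product, `(D - ℓ)
  -- / 2`; beyond it, `m` and `g • m` lie at distance `ℓ / 2` on different branches.
  obtain ⟨r, r1, r2⟩ := exists_between (g • p) p (s := (D - ℓ) / 2) (by linarith)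
    (by rw [dist_comm]; linarith)
  obtain ⟨q, q1, q2⟩ := exists_between (g • p) (g • g • p) (s := (D - ℓ) / 2) (by linarith)
    (by linarith)
  have c1 := dist_comm p (g • p)
  have hrq : r = q := eq_of_le_gromov (by linarith) (by linarith) (by linarith)
    (by linarith)
  subst hrq
  have m1' : dist (g • p) (g • m) = D / 2 := by rw [dist_smul, m1]
  have m2' : dist (g • m) (g • g • p) = D / 2 := by rw [dist_smul, m2]; ring
  obtain ⟨u, u1, u2⟩ := exists_between r p (s := ℓ / 2) (by linarith) (by linarith)
  obtain ⟨v, v1, v2⟩ := exists_between r (g • g • p) (s := ℓ / 2) (by linarith) (by linarith)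
  have hu : m = u := by
    have t1 := dist_triangle (g • p) r u
    have t2 := dist_triangle (g • p) u p
    have t3 := dist_comm m (g • p)
    have t4 := dist_comm m p
    exact eq_of_between (x := g • p) (y := p) (by linarith) (by linarith) (by linarith)
  have hv : g • m = v := by
    have t1 := dist_triangle (g • p) r v
    have t2 := dist_triangle (g • p) v (g • g • p)
    exact eq_of_between (x := g • p) (y := g • g • p) (by linarith) (by linarith) (by linarith)
  have hm1 : dist m (g • m) = ℓ := by
    refine le_antisymm ?_ ?_
    · rw [hv, hu]
      linarith [dist_triangle u r v, dist_comm u r]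
    · linarith [dist_triangle p m (g • g • p), dist_triangle m (g • m) (g • g • p)]
  have hm2 : 2 * ℓ ≤ dist m (g • g • m) := by
    have : dist (g • g • m) (g • g • g • p) = D / 2 := by rw [dist_smul, m2']
    linarith [dist_triangle p m (g • g • g • p), dist_triangle m (g • g • m) (g • g • g • p)]
  obtain ⟨e, he, -⟩ := exists_fixed_end_of_translation hℓ0 hm1 hm2
  exact ⟨e, he⟩

theorem bus_smul_left {g : G} {a : Ends T} (h : g • a = a) (x y : T) :
    bus a (g • x) (g • y) = bus a x y := by
  conv_lhs => rw [← h]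
  exact bus_smul g a x y

/-- The translation length of an element fixing an end does not depend on the base point. -/
theorem bus_smul_self {g : G} {a : Ends T} (h : g • a = a) (p q : T) :
    bus a (g • p) p = bus a (g • q) q := by
  linarith [bus_smul_left h p q, bus_add a (g • p) (g • q) p, bus_add a (g • q) q p,
    bus_neg a p q]

theorem bus_mul_smul {g h : G} {a : Ends T} (hg : g • a = a) (p : T) :
    bus a ((g * h) • p) p = bus a (g • p) p + bus a (h • p) p := by
  rw [mul_smul, ← bus_add a (g • h • p) (h • p) p, bus_smul_self hg (h • p) p]

theorem bus_inv_smul {g : G} {a : Ends T} (hg : g • a = a) (p : T) :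
    bus a (g⁻¹ • p) p = -bus a (g • p) p := by
  have := bus_mul_smul (h := g⁻¹) hg p
  rw [mul_inv_cancel, one_smul, bus_self] at this
  linarith

theorem smul_pow_eq {α : Type*} [MulAction G α] {g : G} {a : α} (hg : g • a = a) (n : ℕ) :
    g ^ n • a = a :=
  (MulAction.stabilizer G a).pow_mem (x := g) hg n

theorem bus_pow_smul {g : G} {a : Ends T} (hg : g • a = a) (p : T) (n : ℕ) :
    bus a (g ^ n • p) p = n * bus a (g • p) p := by
  induction n with
  | zero => simp
  | succ n ih =>
    rw [pow_succ, bus_mul_smul (smul_pow_eq hg n), ih]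
    push_cast
    ring

theorem bus_conj_smul (u h : G) (a : Ends T) (p : T) :
    bus (u • a) ((u * h * u⁻¹) • p) p = bus a (h • u⁻¹ • p) (u⁻¹ • p) := by
  rw [← bus_smul u a, ← mul_smul, ← mul_smul, smul_inv_smul, mul_assoc]

/-- Translation towards one end of a line is translation away from the other end. -/
theorem bus_smul_other {g : G} {a b : Ends T} (hab : a ≠ b) (ha : g • a = a) (hb : g • b = b)
    (p : T) : bus b (g • p) p = -bus a (g • p) p := by
  have h1 := gp_sub_gp hab (g • p) p
  have h2 := gp_smul g a b p
  rw [ha, hb] at h2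
  linarith

/-- An element which fixes an end and does not preserve its horospheres fixes a second end. -/
theorem exists_second_fixed_end {g : G} {a : Ends T} (ha : g • a = a) {p : T}
    (hp : bus a (g • p) p ≠ 0) : ∃ b, b ≠ a ∧ g • b = b := by
  wlog hneg : bus a (g • p) p < 0 generalizing g
  · have h' := bus_inv_smul ha p
    obtain ⟨b, hb, hg⟩ := this (g := g⁻¹) (inv_smul_eq_iff.2 ha.symm)
      (by rw [h']; exact neg_ne_zero.2 hp)
      (by rw [h']; exact neg_lt_zero.2 (lt_of_le_of_ne (not_lt.1 hneg) hp.symm))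
    exact ⟨b, hb, (inv_smul_eq_iff.1 hg).symm⟩
  set τ := -bus a (g • p) p with hτ
  have hτ0 : 0 < τ := by linarith
  obtain ⟨γ, hγ⟩ := exists_conv a
  have hγ' := hγ.smul g
  rw [ha] at hγ'
  -- A ray to `a` meets its image, so a point `y` of it is moved along the ray by `τ`. The second
  -- end is the limit of the points `g⁻¹ ^ n • y`; it differs from `a` because `g⁻¹` moves away from
  -- `a`.
  obtain ⟨t, t', -, -, ht, ht', he⟩ := hγ.exists_eq hγ' 0
  set y := γ t' with hy
  have hb : bus a (g • y) y = -τ := by rw [bus_smul_self ha y p]; ring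
  have htt : t = t' + τ := by
    have e1 := hγ.bus_ray ht
    have e2 := hγ.bus_ray ht'
    rw [← he] at hb
    linarith [bus_add a (γ t) y (γ 0)]
  have d1 : dist y (g • y) = τ := by
    rw [← he, hγ.1.dist_of_le ht' (by linarith), htt]
    ring
  have h1 : dist y (g⁻¹ • y) = τ := by
    rw [← dist_smul g, smul_inv_smul, dist_comm, d1]
  have h2 : 2 * τ ≤ dist y (g⁻¹ • g⁻¹ • y) := by
    have := bus_le_dist a (g • g • y) y
    have e1 := bus_smul_left ha (g • y) y
    rw [← dist_smul g, ← dist_smul g, smul_inv_smul, smul_inv_smul]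
    linarith [neg_dist_le_bus a (g • g • y) y, bus_add a (g • g • y) (g • y) y]
  obtain ⟨e, hge, hbe⟩ := exists_fixed_end_of_translation hτ0 h1 h2
  refine ⟨e, ?_, (inv_smul_eq_iff.1 hge).symm⟩
  rintro rfl
  rw [bus_inv_smul ha] at hbe
  linarith

end Dynamics

/-! ### Directions at a point described by ends -/

section Direction

variable {T : Type*} [MetricSpace T] [IsRTree T]

theorem exists_isRayFrom (x : T) (e : Ends T) :
    ∃ R : {R : Set T // IsRayFrom x R}, ∃ γ : ℝ → T, γ 0 = x ∧ Conv γ e ∧ γ '' Set.Ici 0 = R.1 := by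
  obtain ⟨γ, rfl, h⟩ := exists_conv_from x e
  exact ⟨⟨_, h.1.isRayFrom⟩, γ, rfl, h, rfl⟩

/-- The direction at `x` which points to the end `e`. -/
noncomputable def dir (x : T) (e : Ends T) : Directions x :=
  Quotient.mk (directionSetoid x) (exists_isRayFrom x e).choose

/-- The rays from `x` to `e` and `e'` coincide exactly up to time `gp e e' x`. -/
theorem dir_eq_iff {x : T} {e e' : Ends T} (h : e ≠ e') :
    dir x e = dir x e' ↔ 0 < gp e e' x := by
  obtain ⟨γ, h0, hγ, hR⟩ := (exists_isRayFrom x e).choose_spec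
  obtain ⟨γ', h0', hγ', hR'⟩ := (exists_isRayFrom x e').choose_spec
  have h00 : γ 0 = γ' 0 := h0.trans h0'.symm
  refine (Quotient.eq (r := directionSetoid x)).trans ?_
  show (∃ y ∈ (exists_isRayFrom x e).choose.1 ∩ (exists_isRayFrom x e').choose.1, y ≠ x) ↔ _
  rw [← hR, ← hR']
  constructor
  · rintro ⟨_, ⟨⟨t, ht, rfl⟩, ⟨t', ht', htt⟩⟩, hne⟩
    have d := hγ.1.dist_zero ht
    have d' := hγ'.1.dist_zero ht'
    rw [← h00, htt] at d'
    obtain rfl : t = t' := d.symm.trans d'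
    have ht0 : 0 < t := lt_of_le_of_ne ht fun h => hne (by rw [← h, h0])
    have := (hγ.eq_iff_le_gp h hγ' h00 ht).1 htt.symm
    rw [h0] at this
    linarith
  · intro hpos
    have := (hγ.eq_iff_le_gp h hγ' h00 hpos.le).2 (h0 ▸ le_rfl)
    refine ⟨_, ⟨⟨_, hpos.le, rfl⟩, ⟨_, hpos.le, this.symm⟩⟩, fun hx => ?_⟩
    have d := hγ.1.dist_zero hpos.le
    rw [hx, h0, dist_self] at d
    exact hpos.ne d

theorem dir_ne_iff {x : T} {e e' : Ends T} (h : e ≠ e') :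
    dir x e ≠ dir x e' ↔ gp e e' x = 0 := by
  rw [Ne, dir_eq_iff h, not_lt]
  exact ⟨fun h' => le_antisymm h' (gp_nonneg h x), fun h' => h'.le⟩

theorem dir_surjective (x : T) : Function.Surjective (dir x) := by
  intro d
  induction d using Quotient.inductionOn with
  | h R =>
    obtain ⟨R, hR⟩ := R
    obtain ⟨γ, hγ, h0, hγR⟩ := hR.exists_isGeodRay
    obtain ⟨e, he⟩ := hγ.exists_conv
    obtain ⟨γ', h0', hγ', hR'⟩ := (exists_isRayFrom x e).choose_spec
    refine ⟨e, Quotient.sound ?_⟩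
    show ∃ y ∈ (exists_isRayFrom x e).choose.1 ∩ R, y ≠ x
    rw [← hR', ← hγR]
    refine ⟨γ' 1, ⟨⟨1, Set.mem_Ici.2 zero_le_one, rfl⟩, ⟨1, Set.mem_Ici.2 zero_le_one, ?_⟩⟩, fun hx => ?_⟩
    · exact he.eqOn hγ' (h0.trans h0'.symm) zero_le_one
    · have d := hγ'.1.dist_zero zero_le_one
      rw [hx, h0', dist_self] at d
      exact zero_ne_one d

theorem dir_smul_eq_iff {G : Type*} [Group G] [MulAction G T] [IsIsometricSMul G T] {g : G}
    {x : T} (hg : g • x = x) (e e' : Ends T) :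
    dir x (g • e) = dir x (g • e') ↔ dir x e = dir x e' := by
  by_cases h : e = e'
  · simp [h]
  · rw [dir_eq_iff h, dir_eq_iff (fun h' => h (MulAction.injective g h')), ← gp_smul g e e' x, hg]

theorem exists_three_of_three_le {α : Type*} (h : 3 ≤ Cardinal.mk α) :
    ∃ a b c : α, a ≠ b ∧ a ≠ c ∧ c ≠ b := by
  have h' : Nonempty (Fin 3 ↪ α) := by
    rw [← Cardinal.lift_mk_le']
    simpa using h
  obtain ⟨i⟩ := h'
  exact ⟨i 0, i 1, i 2, by simp, by simp, by simp⟩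

end Direction

/-- Jordan's theorem: a transitive action on a finite set with at least two elements has an
element without fixed points. -/
theorem exists_forall_smul_ne {H Ω : Type*} [Group H] [MulAction H Ω] [Finite Ω] [Nontrivial Ω]
    [MulAction.IsPretransitive H Ω] : ∃ h : H, ∀ ω : Ω, h • ω ≠ ω := by
  classical
  have := Fintype.ofFinite Ω
  -- The group may be infinite; its image among the permutations of `Ω` is finite and can be used
  -- for counting.
  let K := (MulAction.toPermHom H Ω).range
  have := Fintype.ofFinite K
  by_contra! hcon
  have hK : ∀ k : K, ∃ ω : Ω, k • ω = ω := by
    rintro ⟨_, h, rfl⟩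
    exact hcon h
  have htr : MulAction.IsPretransitive K Ω := ⟨fun x y => by
    obtain ⟨h, hh⟩ := MulAction.exists_smul_eq H x y
    exact ⟨⟨_, h, rfl⟩, hh⟩⟩
  have hsub : Subsingleton (Quotient (MulAction.orbitRel K Ω)) :=
    (MulAction.pretransitive_iff_subsingleton_quotient K Ω).1 htr
  have := Fintype.ofFinite (Quotient (MulAction.orbitRel K Ω))
  -- By Burnside the average number of fixed points is one; since the identity has more, some
  -- element has none.
  have hB := MulAction.sum_card_fixedBy_eq_card_orbits_mul_card_group K Ω
  have hle : Fintype.card (Quotient (MulAction.orbitRel K Ω)) ≤ 1 :=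
    Fintype.card_le_one_iff_subsingleton.2 hsub
  have hlt : ∑ _k : K, 1 < ∑ k : K, Fintype.card (MulAction.fixedBy Ω k) := by
    refine Finset.sum_lt_sum (fun k _ => ?_) ⟨1, Finset.mem_univ _, ?_⟩
    · obtain ⟨ω, hω⟩ := hK k
      exact Fintype.card_pos_iff.2 ⟨⟨ω, hω⟩⟩
    · obtain ⟨ω, ω', hne⟩ := exists_pair_ne Ω
      exact Fintype.one_lt_card_iff.2
        ⟨⟨ω, one_smul _ _⟩, ⟨ω', one_smul _ _⟩, fun h => hne (congrArg Subtype.val h)⟩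
  rw [hB, Finset.sum_const, Finset.card_univ, smul_eq_mul, mul_one] at hlt
  nlinarith

/-! ### Consequences of two-transitivity on ends -/

section TwoTransitive

variable {T : Type*} [MetricSpace T] [IsRTree T] {G : Type*} [Group G] [MulAction G T]
  [IsIsometricSMul G T]

/-- A nontrivial translation towards or away from `a` fixes a second end, which can be conjugated to
`b` inside the stabiliser of `a`. The element `k` serves to cancel the translation part of `g`
without moving `b`. -/
theorem exists_bus_eq_of_fixed
    (h2 : ∀ a b c d : Ends T, a ≠ b → c ≠ d → ∃ g : G, g • a = c ∧ g • b = d)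
    {a b : Ends T} (hab : a ≠ b) {g : G} (hg : g • a = a) (x : T) :
    ∃ k : G, k • a = a ∧ k • b = b ∧ bus a (k • x) x = bus a (g • x) x := by
  by_cases h0 : bus a (g • x) x = 0
  · exact ⟨1, one_smul _ _, one_smul _ _, by rw [one_smul, bus_self, h0]⟩
  obtain ⟨d, hda, hgd⟩ := exists_second_fixed_end hg h0
  obtain ⟨u, hua, hud⟩ := h2 a d a b hda.symm hab
  have hu' : u⁻¹ • a = a := inv_smul_eq_iff.2 hua.symm
  refine ⟨u * g * u⁻¹, ?_, ?_, ?_⟩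
  · rw [mul_smul, mul_smul, hu', hg, hua]
  · rw [mul_smul, mul_smul, inv_smul_eq_iff.2 hud.symm, hgd, hud]
  · have := bus_conj_smul u g a x
    rw [hua] at this
    rw [this, bus_smul_self hg]

/-- The stabiliser of a point and an end acts transitively on the opposite ends. -/
theorem exists_smul_eq_of_gp_eq_zero
    (h2 : ∀ a b c d : Ends T, a ≠ b → c ≠ d → ∃ g : G, g • a = c ∧ g • b = d)
    {a b c : Ends T} (hab : a ≠ b) (hac : a ≠ c) {x : T} (hb : gp a b x = 0)
    (hc : gp a c x = 0) : ∃ g : G, g • x = x ∧ g • a = a ∧ g • b = c := by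
  obtain ⟨g, ga, gb⟩ := h2 a b a c hab hac
  obtain ⟨k, ka, kb, hk⟩ := exists_bus_eq_of_fixed h2 hab ga x
  have ka' : k⁻¹ • a = a := inv_smul_eq_iff.2 ka.symm
  have ha : (g * k⁻¹) • a = a := by rw [mul_smul, ka', ga]
  have hbc : (g * k⁻¹) • b = c := by rw [mul_smul, inv_smul_eq_iff.2 kb.symm, gb]
  refine ⟨g * k⁻¹, ?_, ha, hbc⟩
  refine eq_of_gp_eq_zero hac ?_ hc ?_
  · have := gp_smul (g * k⁻¹) a b x
    rwa [ha, hbc, hb] at this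
  · rw [bus_mul_smul ga, bus_inv_smul ka, hk, add_neg_cancel]

/-- The action of the stabiliser of a point on the directions at this point. -/
@[reducible] noncomputable def dirAction (x : T) :
    MulAction (MulAction.stabilizer G x) (Directions x) where
  smul g d := dir x (g.1 • Function.surjInv (dir_surjective x) d)
  one_smul d := by
    show dir x ((1 : G) • _) = d
    rw [one_smul, Function.surjInv_eq (dir_surjective x)]
  mul_smul g g' d := by
    show dir x ((g.1 * g'.1) • _) = dir x (g.1 • _)
    rw [mul_smul, dir_smul_eq_iff g.2, Function.surjInv_eq (dir_surjective x)]
    rfl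

theorem dir_smul_surjInv {g : G} {x : T} (hg : g • x = x) (e : Ends T) :
    dir x (g • Function.surjInv (dir_surjective x) (dir x e)) = dir x (g • e) := by
  rw [dir_smul_eq_iff hg, Function.surjInv_eq (dir_surjective x)]

/-- Some element of the stabiliser of a branch point moves every direction. -/
theorem exists_forall_dir_smul_ne
    (h2 : ∀ a b c d : Ends T, a ≠ b → c ≠ d → ∃ g : G, g • a = c ∧ g • b = d)
    {x : T} [Finite (Directions x)] {a b e : Ends T} (hab : a ≠ b) (hae : a ≠ e) (heb : e ≠ b)
    (h1 : gp a b x = 0) (h2' : gp a e x = 0) (h3 : gp e b x = 0) :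
    ∃ g : G, g • x = x ∧ ∀ d : Ends T, dir x (g • d) ≠ dir x d := by
  let := dirAction (G := G) x
  rw [← dir_ne_iff hab] at h1
  rw [← dir_ne_iff hae] at h2'
  rw [← dir_ne_iff heb] at h3
  have hnt : Nontrivial (Directions x) := ⟨_, _, h1⟩
  have htr : MulAction.IsPretransitive (MulAction.stabilizer G x) (Directions x) := by
    refine ⟨fun d d' => ?_⟩
    obtain ⟨p, rfl⟩ := dir_surjective x d
    obtain ⟨q, rfl⟩ := dir_surjective x d'
    by_cases hpq : dir x p = dir x q
    · exact ⟨1, by rw [one_smul, hpq]⟩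
    -- With at least three directions available, some third direction is opposite to both `p` and
    -- `q`; the stabiliser of `x` and `r` then moves `p` to `q`.
    obtain ⟨r, hrp, hrq⟩ : ∃ r, dir x r ≠ dir x p ∧ dir x r ≠ dir x q := by
      by_contra! hcon
      have ca := hcon a
      have cb := hcon b
      have ce := hcon e
      by_cases ha : dir x a = dir x p
      · have hb : dir x b = dir x q := cb fun h => h1 (ha.trans h.symm)
        have he : dir x e = dir x q := ce fun h => h2' (ha.trans h.symm)
        exact h3 (he.trans hb.symm)
      · have ha' := ca ha
        have hb : dir x b = dir x p := by
          by_contra h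
          exact h1 (ha'.trans (cb h).symm)
        have he : dir x e = dir x p := by
          by_contra h
          exact h2' (ha'.trans (ce h).symm)
        exact h3 (he.trans hb.symm)
    have nrp : r ≠ p := fun h => hrp (by rw [h])
    have nrq : r ≠ q := fun h => hrq (by rw [h])
    obtain ⟨g, gx, -, gp⟩ := exists_smul_eq_of_gp_eq_zero h2 nrp nrq ((dir_ne_iff nrp).1 hrp)
      ((dir_ne_iff nrq).1 hrq)
    exact ⟨⟨g, gx⟩, by rw [← gp]; exact dir_smul_surjInv gx p⟩
  obtain ⟨⟨g, hg⟩, h⟩ := exists_forall_smul_ne (H := MulAction.stabilizer G x)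
    (Ω := Directions x)
  exact ⟨g, hg, fun d hd => h (dir x d) ((dir_smul_surjInv hg d).trans hd)⟩

/-- If `G` contains translations then ends are not isolated. -/
theorem exists_near_end
    (h2 : ∀ a b c d : Ends T, a ≠ b → c ≠ d → ∃ g : G, g • a = c ∧ g • b = d)
    {g : G} {a : Ends T} (ha : g • a = a) {p : T} (hp : bus a (g • p) p ≠ 0)
    {b c e : Ends T} (hbc : b ≠ c) (hbe : b ≠ e) (hec : e ≠ c) (x : T) (r : ℝ) :
    ∃ b', b ≠ b' ∧ r < gp b b' x := by
  obtain ⟨d, hda, hgd⟩ := exists_second_fixed_end ha hp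
  obtain ⟨u, ua, ud⟩ := h2 a d b e hda.symm hbe
  -- After conjugation and possibly inversion, `k` translates along the line from `e` to `b`,
  -- towards `b`, so `k ^ n • c` tends to `b`.
  obtain ⟨k, kb, ke, hk⟩ : ∃ k : G, k • b = b ∧ k • e = e ∧ bus b (k • x) x < 0 := by
    have kb : (u * g * u⁻¹) • b = b := by
      rw [mul_smul, mul_smul, inv_smul_eq_iff.2 ua.symm, ha, ua]
    have ke : (u * g * u⁻¹) • e = e := by
      rw [mul_smul, mul_smul, inv_smul_eq_iff.2 ud.symm, hgd, ud]
    have hb : bus b ((u * g * u⁻¹) • x) x = bus a (g • p) p := by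
      have := bus_conj_smul u g a x
      rw [ua] at this
      rw [this, bus_smul_self ha]
    rcases lt_or_gt_of_ne hp with h | h
    · exact ⟨_, kb, ke, by rwa [hb]⟩
    · exact ⟨(u * g * u⁻¹)⁻¹, inv_smul_eq_iff.2 kb.symm, inv_smul_eq_iff.2 ke.symm,
        by rw [bus_inv_smul kb, hb]; linarith⟩
  obtain ⟨n, hn⟩ := exists_nat_gt ((r + gp e c x) / -bus b (k • x) x)
  rw [div_lt_iff₀ (by linarith)] at hn
  have kbn := smul_pow_eq kb n
  have ken := smul_pow_eq ke n
  refine ⟨k ^ n • c, fun h => hbc (MulAction.injective (k ^ n) (kbn.trans h)), ?_⟩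
  have e1 := gp_smul (k ^ n) b c ((k ^ n)⁻¹ • x)
  rw [kbn, smul_inv_smul] at e1
  have e2 := gp_sub_gp hbc ((k ^ n)⁻¹ • x) x
  have e3 := gp_sub_gp hec ((k ^ n)⁻¹ • x) x
  have e4 := gp_nonneg hec ((k ^ n)⁻¹ • x)
  have e5 := gp_nonneg hbc x
  rw [bus_inv_smul kbn, bus_pow_smul kb] at e2
  rw [bus_inv_smul ken, bus_pow_smul ke, bus_smul_other hbe kb ke] at e3
  linarith

end TwoTransitive

/-! ### Ping-pong: products of long translations fix an end -/

section PingPong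

variable {T : Type*} [MetricSpace T] [IsRTree T] {G : Type*} [Group G] [MulAction G T]
  [IsIsometricSMul G T]

/-- The hypotheses bound the backtracking along `p, s • p, s • t • p, ...`. Two uses of the four
point condition show that `(s * t) ^ 2` moves `p` further than `s * t` does. -/
theorem exists_fixed_end_of_two_letters {s t : G} {p : T}
    (h1 : dist p (s • p) < dist (s⁻¹ • p) (t • p)) (h2 : dist p (t • p) < dist (s⁻¹ • p) (t • p))
    (h3 : dist p (s • p) < dist (t⁻¹ • p) (s • p)) (h4 : dist p (t • p) < dist (t⁻¹ • p) (s • p)) :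
    ∃ e : Ends T, (s * t) • e = e := by
  refine exists_fixed_end_of_lt (p := p) ?_
  simp only [mul_smul]
  have f1 := four_point p (s • t • p) (s • p) (s • t • s • p)
  have f2 := four_point p (s • t • s • p) (s • t • p) (s • t • s • t • p)
  have e1 : dist p (s • t • p) = dist (s⁻¹ • p) (t • p) := by
    rw [← dist_smul s (s⁻¹ • p), smul_inv_smul]
  have e2 : dist (s • p) (s • t • s • p) = dist (t⁻¹ • p) (s • p) := by
    rw [dist_smul, ← dist_smul t (t⁻¹ • p), smul_inv_smul]
  have e3 : dist (s • p) (s • t • p) = dist p (t • p) := dist_smul _ _ _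
  have e4 : dist (s • t • p) (s • t • s • p) = dist p (s • p) := by rw [dist_smul, dist_smul]
  have e5 : dist (s • t • p) (s • t • s • t • p) = dist (s⁻¹ • p) (t • p) := by
    rw [dist_smul, dist_smul, ← dist_smul s (s⁻¹ • p), smul_inv_smul]
  have e6 : dist (s • t • s • p) (s • t • s • t • p) = dist p (t • p) := by
    rw [dist_smul, dist_smul, dist_smul]
  have c1 := dist_comm (s • p) (s • t • p)
  have c2 := dist_comm (s • t • p) (s • t • s • p)
  have : dist p (s • t • p) < dist p (s • t • s • p) := by
    rcases le_max_iff.1 f1 with f | f <;> linarith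
  rcases le_max_iff.1 f2 with f | f <;> linarith

/-- If `x` is far out towards `e` and `y` far out towards `e'`, the geodesic between them must come
back near `p`. -/
theorem le_dist_of_ends {e e' : Ends T} (h : e ≠ e') (x y p : T) :
    -bus e x p - bus e' y p - 2 * gp e e' p ≤ dist x y := by
  linarith [bus_le_dist e' x y, bus_add e' x y p, gp_sub_gp h x p, gp_nonneg h x]

/-- The bound is the length of a path from `p` to the axis, along the axis, and back to `h • p`. -/
theorem dist_smul_le {h : G} {a b : Ends T} (hab : a ≠ b) (ha : h • a = a) (hb : h • b = b)
    (p : T) : dist p (h • p) ≤ |bus a (h • p) p| + 2 * gp a b p := by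
  obtain ⟨γ, γ', -, -, -, -, hg, hd⟩ := exists_line hab p
  have h0 : gp a b (γ 0) = 0 := by simp [hg]
  have h1 : gp a b (h • γ 0) = 0 := by
    have := gp_smul h a b (γ 0)
    rwa [ha, hb, h0] at this
  have := dist_eq_abs_bus hab h1 h0
  rw [bus_smul_self ha _ p] at this
  have e : dist (h • p) (h • γ 0) = gp a b p := by rw [dist_smul, hd]
  linarith [dist_triangle p (γ 0) (h • p), dist_triangle (γ 0) (h • γ 0) (h • p),
    dist_comm (h • p) (h • γ 0), dist_comm (γ 0) (h • γ 0)]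

/-- Two translations `h`, `k` with different attracting ends and different repelling ends: if
they are long then `g * k⁻¹ * h` fixes an end. -/
theorem exists_fixed_end_of_long {g h k : G} {a b a' b' : Ends T} (hab : a ≠ b) (hab' : a' ≠ b')
    (haa : a ≠ a') (hbb : b ≠ g • b') (ha : h • a = a) (hb : h • b = b) (ha' : k • a' = a')
    (hb' : k • b' = b') (p : T) (hk : bus a' (k • p) p = bus a (h • p) p)
    (hL : bus a (h • p) p + (2 * dist p (g • p) + 2 * gp a a' p + 2 * gp b (g • b') p
      + 2 * gp a b p + 2 * gp a' b' p) < 0) :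
    ∃ e : Ends T, (g * k⁻¹ * h) • e = e := by
  set L := -bus a (h • p) p with hLdef
  have d0 : 0 ≤ dist p (g • p) := dist_nonneg
  have g1 := gp_nonneg haa p
  have g2 := gp_nonneg hbb p
  have g3 := gp_nonneg hab p
  have g4 := gp_nonneg hab' p
  have D1 : dist p (h • p) ≤ L + 2 * gp a b p := by
    have := dist_smul_le hab ha hb p
    rwa [abs_of_neg (by linarith)] at this
  have D2 : dist p (k • p) ≤ L + 2 * gp a' b' p := by
    have := dist_smul_le hab' ha' hb' p
    rwa [hk, abs_of_neg (by linarith)] at this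
  have D3 : dist p ((g * k⁻¹) • p) ≤ dist p (g • p) + L + 2 * gp a' b' p := by
    have e1 : dist (g • p) ((g * k⁻¹) • p) = dist p (k • p) := by
      rw [mul_smul, dist_smul, ← dist_smul k, smul_inv_smul, dist_comm]
    linarith [dist_triangle p (g • p) ((g * k⁻¹) • p)]
  -- With `s = g * k⁻¹` and `t = h`, each letter displaces `p` by about `L`. The points `s⁻¹ • p`
  -- and `t • p` move towards the distinct ends `a'` and `a`, so their distance is about `2 * L`;
  -- `E2` does the same with `g • b'` and `b`.
  have E1 : 2 * L - dist p (g • p) - 2 * gp a a' p ≤ dist ((g * k⁻¹)⁻¹ • p) (h • p) := by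
    have e1 : bus a' ((g * k⁻¹)⁻¹ • p) p ≤ dist p (g • p) - L := by
      have : dist (g⁻¹ • p) p = dist p (g • p) := by rw [← dist_smul g, smul_inv_smul]
      rw [mul_inv_rev, inv_inv, bus_mul_smul ha', hk]
      linarith [bus_le_dist a' (g⁻¹ • p) p]
    linarith [le_dist_of_ends haa (h • p) ((g * k⁻¹)⁻¹ • p) p,
      dist_comm (h • p) ((g * k⁻¹)⁻¹ • p)]
  have E2 : 2 * L - dist p (g • p) - 2 * gp b (g • b') p ≤ dist (h⁻¹ • p) ((g * k⁻¹) • p) := by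
    have e1 : bus b (h⁻¹ • p) p = -L := by
      rw [bus_inv_smul hb, bus_smul_other hab ha hb]
    have e2 : bus (g • b') ((g * k⁻¹) • p) p ≤ dist p (g • p) - L := by
      have e3 : bus (g • b') (g • k⁻¹ • p) (g • p) = -L := by
        rw [bus_smul, bus_inv_smul hb', bus_smul_other hab' ha' hb', hk]
      rw [mul_smul]
      linarith [bus_add (g • b') (g • k⁻¹ • p) (g • p) p, bus_le_dist (g • b') (g • p) p,
        dist_comm p (g • p)]
    linarith [le_dist_of_ends hbb (h⁻¹ • p) ((g * k⁻¹) • p) p]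
  exact exists_fixed_end_of_two_letters (p := p) (by linarith) (by linarith) (by linarith)
    (by linarith)

end PingPong

/-! ### Proportional homomorphisms to the reals -/

theorem eq_zero_of_forall_mul_abs_le {x M : ℝ} (h : ∀ n : ℕ, n * |x| ≤ M) : x = 0 := by
  by_contra hx
  obtain ⟨n, hn⟩ := exists_nat_gt (M / |x|)
  rw [div_lt_iff₀ (abs_pos.2 hx)] at hn
  exact (h n).not_gt hn

/-- Two homomorphisms to `ℝ`, each of which is bounded where the other one is bounded, are
proportional. -/
theorem exists_ratio_of_bounded {H : Type*} [AddGroup H] (u v : H →+ ℝ)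
    (huv : ∀ r, ∃ M, ∀ h, |v h| ≤ r → |u h| ≤ M) (hvu : ∀ r, ∃ M, ∀ h, |u h| ≤ r → |v h| ≤ M) :
    ∃ c : ℝ, c ≠ 0 ∧ ∀ h, u h = c * v h := by
  have aux : ∀ u v : H →+ ℝ, (∀ r, ∃ M, ∀ h, |v h| ≤ r → |u h| ≤ M) →
      ∀ h, v h = 0 → u h = 0 := by
    intro u v huv h hv
    obtain ⟨M, hM⟩ := huv 0
    refine eq_zero_of_forall_mul_abs_le (M := M) fun n => ?_
    have := hM (n • h) (by simp [hv])
    rwa [map_nsmul, nsmul_eq_mul, abs_mul, Nat.abs_cast] at this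
  by_cases hv : ∀ h, v h = 0
  · exact ⟨1, one_ne_zero, fun h => by rw [hv h, aux u v huv h (hv h), mul_zero]⟩
  push Not at hv
  obtain ⟨k, hk⟩ := hv
  refine ⟨u k / v k, div_ne_zero (fun hu => hk (aux v u hvu k hu)) hk, fun h => ?_⟩
  obtain ⟨M, hM⟩ := huv |v k|
  refine sub_eq_zero.1 (eq_zero_of_forall_mul_abs_le (M := M + |u k|) fun n => ?_)
  -- The integer `⌊t⌋` makes `v (n • h - ⌊t⌋ • k)` bounded uniformly in `n`. So `u` is bounded there
  -- too, and `n` times the failure of proportionality stays bounded.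
  set t := n * v h / v k with ht
  have hf : |t - ⌊t⌋| ≤ 1 := by
    rw [abs_of_nonneg (by linarith [Int.floor_le t])]
    linarith [Int.lt_floor_add_one t]
  have e1 : |v (n • h - ⌊t⌋ • k)| ≤ |v k| := by
    have : v (n • h - ⌊t⌋ • k) = (t - ⌊t⌋) * v k := by
      rw [map_sub, map_nsmul, map_zsmul, nsmul_eq_mul, zsmul_eq_mul, sub_mul, ht,
        div_mul_cancel₀ _ hk]
    rw [this, abs_mul]
    exact mul_le_of_le_one_left (abs_nonneg _) hf
  have e2 := hM _ e1
  have e3 : n * (u h - u k / v k * v h) = u (n • h - ⌊t⌋ • k) - (t - ⌊t⌋) * u k := by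
    rw [map_sub, map_nsmul, map_zsmul, nsmul_eq_mul, zsmul_eq_mul, ht]
    field_simp
    ring
  calc (n : ℝ) * |u h - u k / v k * v h| = |n * (u h - u k / v k * v h)| := by
        rw [abs_mul, Nat.abs_cast]
    _ ≤ |u (n • h - ⌊t⌋ • k)| + |(t - ⌊t⌋) * u k| := by rw [e3]; exact abs_sub _ _
    _ ≤ M + |u k| := by
        rw [abs_mul]
        exact add_le_add e2 (mul_le_of_le_one_left (abs_nonneg _) hf)

/-! ### Boundedness of translation lengths passes between the trees -/

section Comparison

variable {G T₁ T₂ : Type*} [Group G] [MetricSpace T₁] [IsRTree T₁] [MetricSpace T₂] [IsRTree T₂]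
  [MulAction G T₁] [IsIsometricSMul G T₁] [MulAction G T₂] [IsIsometricSMul G T₂]

theorem two_transitive_map {f : Ends T₁ ≃ Ends T₂}
    (hf : ∀ (g : G) (e : Ends T₁), f (g • e) = g • f e)
    (h2 : ∀ a b c d : Ends T₁, a ≠ b → c ≠ d → ∃ g : G, g • a = c ∧ g • b = d)
    (a b c d : Ends T₂) (hab : a ≠ b) (hcd : c ≠ d) : ∃ g : G, g • a = c ∧ g • b = d := by
  obtain ⟨g, h1, h2⟩ := h2 (f.symm a) (f.symm b) (f.symm c) (f.symm d)
    (f.symm.injective.ne hab) (f.symm.injective.ne hcd)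
  refine ⟨g, ?_, ?_⟩
  · simpa [hf] using congrArg f h1
  · simpa [hf] using congrArg f h2

/-- If two translations have overlapping axes and the same translation length then they agree
on the overlap. -/
theorem inv_mul_smul_eq {T : Type*} [MetricSpace T] [IsRTree T] [MulAction G T]
    [IsIsometricSMul G T] {a b a' b' : Ends T} (haa : a ≠ a') (hbb : b ≠ b') (hab : a ≠ b)
    (hab' : a' ≠ b') {u h : G} (ua : u • a = a') (ub : u • b = b') (ha : h • a = a)
    (hb : h • b = b) {x : T} (h0 : gp a b x = 0) (h0' : gp a' b' x = 0)
    (h1 : |bus a (h • x) x| ≤ gp a a' x) (h2 : |bus a (h • x) x| ≤ gp b b' x) :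
    ((u * h * u⁻¹)⁻¹ * h) • x = x := by
  have ka : (u * h * u⁻¹) • a' = a' := by
    rw [mul_smul, mul_smul, inv_smul_eq_iff.2 ua.symm, ha, ua]
  have kb : (u * h * u⁻¹) • b' = b' := by
    rw [mul_smul, mul_smul, inv_smul_eq_iff.2 ub.symm, hb, ub]
  have ka' : (u * h * u⁻¹)⁻¹ • a' = a' := inv_smul_eq_iff.2 ka.symm
  have kb' : (u * h * u⁻¹)⁻¹ • b' = b' := inv_smul_eq_iff.2 kb.symm
  have hx : gp a b (h • x) = 0 := by
    have := gp_smul h a b x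
    rwa [ha, hb, h0] at this
  have hd := dist_eq_abs_bus hab hx h0
  -- The point `h • x` is still in the overlap of the two lines, where the Busemann functions of `a`
  -- and `a'`, and of `b` and `b'`, agree near `x`.
  have e1 := bus_eq_of_le_gp haa (hd.le.trans h1)
  have e2 := bus_eq_of_le_gp hbb (hd.le.trans h2)
  have e3 := bus_smul_other hab ha hb x
  have e4 := gp_sub_gp hab' (h • x) x
  have e5 := gp_smul (u * h * u⁻¹)⁻¹ a' b' (h • x)
  rw [ka', kb'] at e5
  have e6 : bus a' ((u * h * u⁻¹) • x) x = bus a (h • x) x := by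
    have := bus_conj_smul u h a x
    rw [ua] at this
    rw [this, bus_smul_self ha]
  refine eq_of_gp_eq_zero hab' ?_ h0' ?_
  · rw [mul_smul, e5]
    linarith
  · rw [bus_mul_smul ka', bus_inv_smul ka, e6, e1]
    ring

/-- Elements fixing two ends which have bounded translation length on a locally finite tree
have bounded translation length on the other tree. -/
theorem exists_translation_bound {f : Ends T₁ ≃ Ends T₂}
    (hf : ∀ (g : G) (e : Ends T₁), f (g • e) = g • f e)
    (h2 : ∀ a b c d : Ends T₁, a ≠ b → c ≠ d → ∃ g : G, g • a = c ∧ g • b = d)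
    (hfin : ∀ x : T₂, Finite (Directions x)) {a₁ a₂ a₃ : Ends T₁} (h12 : a₁ ≠ a₂)
    (h13 : a₁ ≠ a₃) (h32 : a₃ ≠ a₂) (p : T₁) (q : T₂) (r : ℝ) :
    ∃ M, ∀ h : G, h • a₁ = a₁ → h • a₂ = a₂ → |bus (f a₁) (h • q) q| ≤ r →
      |bus a₁ (h • p) p| ≤ M := by
  have hf2 := two_transitive_map hf h2
  have hfix : ∀ {h : G} {e : Ends T₁}, h • e = e → h • f e = f e := fun he => by rw [← hf, he]
  by_contra! hcon
  -- By conjugation and inversion, the failure occurs on every line and in either direction.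
  have hcon' : ∀ c d, c ≠ d → ∀ M, ∃ h : G, h • c = c ∧ h • d = d ∧
      |bus (f c) (h • q) q| ≤ r ∧ bus c (h • p) p < -M := by
    intro c d hcd M
    obtain ⟨h, ha, hb, hr, hM⟩ := hcon M
    obtain ⟨u, uc, ud⟩ := h2 a₁ a₂ c d h12 hcd
    have kc : (u * h * u⁻¹) • c = c := by
      rw [mul_smul, mul_smul, inv_smul_eq_iff.2 uc.symm, ha, uc]
    have kd : (u * h * u⁻¹) • d = d := by
      rw [mul_smul, mul_smul, inv_smul_eq_iff.2 ud.symm, hb, ud]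
    have e1 : bus c ((u * h * u⁻¹) • p) p = bus a₁ (h • p) p := by
      have := bus_conj_smul u h a₁ p
      rw [uc] at this
      rw [this, bus_smul_self ha]
    have e2 : bus (f c) ((u * h * u⁻¹) • q) q = bus (f a₁) (h • q) q := by
      have := bus_conj_smul u h (f a₁) q
      rw [← hf, uc] at this
      rw [this, bus_smul_self (hfix ha)]
    rcases lt_abs.1 hM with hM | hM
    · refine ⟨_, inv_smul_eq_iff.2 kc.symm, inv_smul_eq_iff.2 kd.symm, ?_, ?_⟩
      · rwa [bus_inv_smul (hfix kc), abs_neg, e2]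
      · rw [bus_inv_smul kc, e1]
        linarith
    · exact ⟨_, kc, kd, by rwa [e2], by rw [e1]; linarith⟩
  -- Translations of `T₁` exist, so ends are not isolated.
  have hinf : Infinite (Ends T₁) := by
    by_contra hfin
    rw [not_infinite_iff_finite] at hfin
    obtain ⟨h, ha, -, -, hM⟩ := hcon' a₁ a₂ h12 0
    obtain ⟨M, hM'⟩ := (Set.finite_range fun b' => gp a₁ b' p).bddAbove
    obtain ⟨b', -, hb'⟩ := exists_near_end h2 ha (p := p) (by linarith) h12 h13 h32 p M
    exact hb'.not_ge (hM' ⟨b', rfl⟩)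
  obtain ⟨x, x12, x13, x32⟩ := exists_center (f.injective.ne h12) (f.injective.ne h13)
    (f.injective.ne h32) q
  have := hfin x
  obtain ⟨g, gx, hg⟩ := exists_forall_dir_smul_ne hf2 (f.injective.ne h12) (f.injective.ne h13)
    (f.injective.ne h32) x12 x13 x32
  -- The images of `b` and `b'` must share a path from `x` longer than the translation lengths.
  -- Without translations on `T₂`, `r' = 0` suffices and infinitely many ends over finitely many
  -- directions give the pair; otherwise ends of `T₂` accumulate.
  obtain ⟨r', hr', b, b', hbb, hgp, hgp0⟩ : ∃ r', (∀ c d, c ≠ d → ∀ M, ∃ h : G, h • c = c ∧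
      h • d = d ∧ |bus (f c) (h • q) q| ≤ r' ∧ bus c (h • p) p < -M) ∧
      ∃ b b', b ≠ b' ∧ r' < gp (f b) (f b') x ∧ 0 < gp (f b) (f b') x := by
    by_cases hz : ∀ (h : G) (e : Ends T₁), h • e = e → bus (f e) (h • q) q = 0
    · refine ⟨0, fun c d hcd M => ?_, ?_⟩
      · obtain ⟨h, hc, hd, -, hM⟩ := hcon' c d hcd M
        exact ⟨h, hc, hd, by rw [hz h c hc, abs_zero], hM⟩
      · obtain ⟨b, b', hbb, he⟩ := Finite.exists_ne_map_eq_of_infinite fun e => dir x (f e)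
        have := (dir_eq_iff (f.injective.ne hbb)).1 he
        exact ⟨b, b', hbb, this, this⟩
    · push Not at hz
      obtain ⟨h, e, he, hne⟩ := hz
      obtain ⟨b', hb, hb'⟩ := exists_near_end hf2 (hfix he) hne (f.injective.ne h12)
        (f.injective.ne h13) (f.injective.ne h32) x (max r 0)
      refine ⟨r, hcon', a₁, f.symm b', fun h => hb (by simp [h]), ?_, ?_⟩ <;>
        rw [Equiv.apply_symm_apply]
      · exact (le_max_left _ _).trans_lt hb'
      · exact (le_max_right _ _).trans_lt hb'
  have hgb : dir x (f (g • b)) ≠ dir x (f b) := by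
    rw [hf]
    exact hg _
  have hab : g • b ≠ b := fun h => hgb (by rw [h])
  have hgb' : dir x (f (g • b')) ≠ dir x (f b') := by
    rw [hf]
    exact hg _
  have hab' : g • b' ≠ b' := fun h => hgb' (by rw [h])
  have haa : g • b ≠ g • b' := fun h => hbb (MulAction.injective g h)
  have x0 := (dir_ne_iff (f.injective.ne hab)).1 hgb
  have x0' := (dir_ne_iff (f.injective.ne hab')).1 hgb'
  have hgpa : r' < gp (f (g • b)) (f (g • b')) x := by
    have := gp_smul g (f b) (f b') x
    rw [gx, ← hf, ← hf] at this
    rwa [this]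
  obtain ⟨u, ua, ub⟩ := h2 _ _ _ _ hab hab'
  choose h ha hb hr hM using fun n : ℕ => hr' _ _ hab n
  have hr₂ : ∀ n, |bus (f (g • b)) (h n • x) x| ≤ r' := fun n => by
    rw [bus_smul_self (hfix (ha n)) x q]
    exact hr n
  -- On `T₂`, `h n` translates along the line of `g • b` and `b`, its conjugate along that of `g •
  -- b'` and `b'`. Both lines run through `x` and overlap far enough on both sides that `w n` fixes
  -- `x`.
  set w : ℕ → G := fun n => (u * h n * u⁻¹)⁻¹ * h n with hw
  have wx : ∀ n, w n • x = x := fun n =>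
    inv_mul_smul_eq (f.injective.ne haa) (f.injective.ne hbb) (f.injective.ne hab)
      (f.injective.ne hab') (by rw [← hf, ua]) (by rw [← hf, ub]) (hfix (ha n)) (hfix (hb n))
      x0 x0' ((hr₂ n).trans hgpa.le) ((hr₂ n).trans hgp.le)
  -- Local finiteness of `T₂` leaves finitely many self-maps of the directions at `x`, so infinitely
  -- many `w n` act alike.
  obtain ⟨F, hF⟩ := Finite.exists_infinite_fiber fun n (d : Directions x) =>
    dir x (w n • Function.surjInv (dir_surjective x) d)
  rw [Set.infinite_coe_iff] at hF
  obtain ⟨n₀, hn₀⟩ := hF.nonempty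
  have kb : ∀ n, (u * h n * u⁻¹) • b' = b' := fun n => by
    rw [mul_smul, mul_smul, inv_smul_eq_iff.2 ub.symm, hb, ub]
  have ka : ∀ n, (u * h n * u⁻¹) • g • b' = g • b' := fun n => by
    rw [mul_smul, mul_smul, inv_smul_eq_iff.2 ua.symm, ha, ua]
  -- Distinct repelling ends are needed on `T₁`. Equality would make `g` preserve the direction of
  -- `f b` at `x`, because `h n₀` is too short to separate `b` from `(h n₀)⁻¹ • b'` there.
  have hbg : b ≠ (g * (w n₀)⁻¹) • b' := by
    intro hcon
    have e1 : (w n₀)⁻¹ • b' = (h n₀)⁻¹ • b' := by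
      simp only [hw]
      rw [mul_inv_rev, inv_inv, mul_smul, kb]
    have e2 : dir x (f b) = dir x (f ((h n₀)⁻¹ • b')) := by
      have hne : b ≠ (h n₀)⁻¹ • b' := fun hh => hbb (by
        rw [← hb n₀, hh, smul_inv_smul])
      rw [dir_eq_iff (f.injective.ne hne)]
      have e3 := gp_smul (h n₀) (f b) (f ((h n₀)⁻¹ • b')) x
      rw [← hf, ← hf, smul_inv_smul, hb n₀] at e3
      have e4 := gp_sub_gp (f.injective.ne hbb) (h n₀ • x) x
      have hx : gp (f (g • b)) (f b) (h n₀ • x) = 0 := by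
        have := gp_smul (h n₀) (f (g • b)) (f b) x
        rwa [hfix (ha n₀), hfix (hb n₀), x0] at this
      have hd := dist_eq_abs_bus (f.injective.ne hab) hx x0
      have e5 := bus_eq_of_le_gp (f.injective.ne hbb) (hd.le.trans ((hr₂ n₀).trans hgp.le))
      have e6 := neg_dist_le_bus (f b) (h n₀ • x) x
      linarith [hr₂ n₀]
    have e3 : f b = g • f ((h n₀)⁻¹ • b') := by
      rw [← hf, ← e1, ← mul_smul, ← hcon]
    exact hg (f ((h n₀)⁻¹ • b')) (by rw [← e3, e2])
  set g₁ := g * (w n₀)⁻¹ with hg₁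
  obtain ⟨N, hN⟩ := exists_nat_gt (2 * dist p (g₁ • p) + 2 * gp (g • b) (g • b') p
    + 2 * gp b (g₁ • b') p + 2 * gp (g • b) b p + 2 * gp (g • b') b' p)
  obtain ⟨n, hn, hNn⟩ := hF.exists_gt N
  have hNn' : (N : ℝ) < n := by exact_mod_cast hNn
  have hk : bus (g • b') ((u * h n * u⁻¹) • p) p = bus (g • b) (h n • p) p := by
    have := bus_conj_smul u (h n) (g • b) p
    rw [ua] at this
    rw [this, bus_smul_self (ha n)]
  -- On `T₁` the translations are long, so `g * (w n₀)⁻¹ * w n` fixes an end; on directions at `x`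
  -- it acts as `g`, which preserves none.
  obtain ⟨e, he⟩ := exists_fixed_end_of_long hab hab' haa hbg (ha n) (hb n) (ka n) (kb n) p hk
    (by linarith [hM n])
  have e1 : g • (w n₀)⁻¹ • w n • f e = f e := by
    have := hfix he
    rw [mul_assoc g₁] at this
    rw [← mul_smul (w n₀)⁻¹, ← mul_smul g, ← mul_assoc]
    exact this
  have e2 : dir x (w n • f e) = dir x (w n₀ • f e) := by
    have := congrFun ((show _ = F from hn).trans (show _ = F from hn₀).symm) (dir x (f e))
    simpa only [dir_smul_surjInv (wx _)] using this
  have e3 : dir x ((w n₀)⁻¹ • w n • f e) = dir x (f e) := by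
    rw [← dir_smul_eq_iff (wx n₀), smul_inv_smul, e2]
  have := hg ((w n₀)⁻¹ • w n • f e)
  rw [e1, e3] at this
  exact this rfl

end Comparison

/-! ### Proportional translation lengths and Gromov products -/

section Proportional

variable {G T₁ T₂ : Type*} [Group G] [MetricSpace T₁] [IsRTree T₁] [MetricSpace T₂] [IsRTree T₂]
  [MulAction G T₁] [IsIsometricSMul G T₁] [MulAction G T₂] [IsIsometricSMul G T₂]

/-- The translation length of elements fixing a line, as a homomorphism. -/
noncomputable def transHom {T E : Type*} [MetricSpace T] [IsRTree T] [MulAction G T]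
    [IsIsometricSMul G T] [MulAction G E] (a b : E) (e : Ends T)
    (he : ∀ g : G, g • a = a → g • e = e) (p : T) :
    Additive ↥(MulAction.stabilizer G a ⊓ MulAction.stabilizer G b) →+ ℝ :=
  AddMonoidHom.mk' (fun g => bus e (g.toMul.1 • p) p) fun g _ =>
    bus_mul_smul (he g.toMul.1 g.toMul.2.1) p

/-- The translation lengths on the two trees are proportional. -/
theorem exists_translation_ratio {f : Ends T₁ ≃ Ends T₂}
    (hf : ∀ (g : G) (e : Ends T₁), f (g • e) = g • f e)
    (h2 : ∀ a b c d : Ends T₁, a ≠ b → c ≠ d → ∃ g : G, g • a = c ∧ g • b = d)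
    (hfin₁ : ∀ x : T₁, Finite (Directions x)) (hfin₂ : ∀ x : T₂, Finite (Directions x))
    {a b e : Ends T₁} (hab : a ≠ b) (hae : a ≠ e) (heb : e ≠ b) (p : T₁) (q : T₂) :
    ∃ c : ℝ, c ≠ 0 ∧ ∀ (g : G) (d : Ends T₁), g • d = d →
      bus d (g • p) p = c * bus (f d) (g • q) q := by
  have hfix : ∀ {h : G} {e : Ends T₁}, h • e = e → h • f e = f e := fun he => by rw [← hf, he]
  have hfix' : ∀ {h : G} {e : Ends T₂}, h • e = e → h • f.symm e = f.symm e := fun he =>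
    f.injective (by rw [hf, Equiv.apply_symm_apply, he])
  obtain ⟨c, hc, hcab⟩ := exists_ratio_of_bounded
    (transHom (G := G) a b a (fun _ h => h) p) (transHom (G := G) a b (f a) (fun _ => hfix) q)
    (fun r => by
      obtain ⟨M, hM⟩ := exists_translation_bound hf h2 hfin₂ hab hae heb p q r
      exact ⟨M, fun h => hM h.toMul.1 h.toMul.2.1 h.toMul.2.2⟩)
    (fun r => by
      obtain ⟨M, hM⟩ := exists_translation_bound (f := f.symm)
        (fun g e => by rw [Equiv.symm_apply_eq, hf, Equiv.apply_symm_apply])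
        (two_transitive_map hf h2) hfin₁ (f.injective.ne hab) (f.injective.ne hae)
        (f.injective.ne heb) q p r
      rw [Equiv.symm_apply_apply] at hM
      exact ⟨M, fun h => hM h.toMul.1 (hfix h.toMul.2.1) (hfix h.toMul.2.2)⟩)
  refine ⟨c, hc, fun g d hd => ?_⟩
  have key : ∀ d', d ≠ d' → g • d' = d' → bus d (g • p) p = c * bus (f d) (g • q) q := by
    intro d' hdd hd'
    obtain ⟨u, ud, ud'⟩ := h2 d d' a b hdd hab
    have ka : (u * g * u⁻¹) • a = a := by
      rw [mul_smul, mul_smul, inv_smul_eq_iff.2 ud.symm, hd, ud]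
    have kb : (u * g * u⁻¹) • b = b := by
      rw [mul_smul, mul_smul, inv_smul_eq_iff.2 ud'.symm, hd', ud']
    have e0 : bus a ((u * g * u⁻¹) • p) p = c * bus (f a) ((u * g * u⁻¹) • q) q :=
      hcab (Additive.ofMul ⟨u * g * u⁻¹, ka, kb⟩)
    have e1 := bus_conj_smul u g d p
    have e2 := bus_conj_smul u g (f d) q
    rw [ud, bus_smul_self hd _ p] at e1
    rw [← hf, ud, bus_smul_self (hfix hd) _ q] at e2
    rw [← e1, ← e2, e0]
  -- An element fixing no second end has translation length zero in both trees.
  by_cases h1 : bus d (g • p) p = 0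
  · by_cases h1' : bus (f d) (g • q) q = 0
    · rw [h1, h1', mul_zero]
    · obtain ⟨d', hne, hd'⟩ := exists_second_fixed_end (hfix hd) h1'
      exact key (f.symm d') (fun h => hne (by rw [h, Equiv.apply_symm_apply])) (hfix' hd')
  · obtain ⟨d', hne, hd'⟩ := exists_second_fixed_end hd h1
    exact key d' hne.symm hd'

/-- The Gromov products on the two trees are proportional up to a potential. -/
theorem exists_potential {f : Ends T₁ ≃ Ends T₂}
    (hf : ∀ (g : G) (e : Ends T₁), f (g • e) = g • f e)
    (h2 : ∀ a b c d : Ends T₁, a ≠ b → c ≠ d → ∃ g : G, g • a = c ∧ g • b = d)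
    {a₀ b₀ : Ends T₁} (hab : a₀ ≠ b₀) (p : T₁) (q : T₂) {c : ℝ}
    (hc : ∀ (g : G) (d : Ends T₁), g • d = d → bus d (g • p) p = c * bus (f d) (g • q) q) :
    ∃ v : Ends T₁ → ℝ, ∀ a b, a ≠ b →
      gp a b p = c * gp (f a) (f b) q + v a + v b := by
  -- This cocycle is the share of the end `a` in the change of `gp - c * gp` under `g`; by `hc` it
  -- vanishes on stabilisers of ends.
  set ψ : G → Ends T₁ → ℝ := fun g a =>
    (bus a (g⁻¹ • p) p - c * bus (f a) (g⁻¹ • q) q) / 2 with hψ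
  have hmul : ∀ g h a, ψ (g * h) a = ψ g (h • a) + ψ h a := by
    intro g h a
    have e1 := bus_smul h⁻¹ (h • a) (g⁻¹ • p) p
    have e2 := bus_smul h⁻¹ (h • f a) (g⁻¹ • q) q
    rw [inv_smul_smul] at e1 e2
    simp only [hψ]
    rw [mul_inv_rev, mul_smul, mul_smul, hf, ← e1, ← e2,
      ← bus_add a (h⁻¹ • g⁻¹ • p) (h⁻¹ • p) p, ← bus_add (f a) (h⁻¹ • g⁻¹ • q) (h⁻¹ • q) q]
    ring
  have hfix : ∀ g a, g • a = a → ψ g a = 0 := by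
    intro g a ha
    simp only [hψ]
    rw [hc g⁻¹ a (inv_smul_eq_iff.2 ha.symm)]
    ring
  have hgp : ∀ (g : G) a b, a ≠ b → gp (g • a) (g • b) p - c * gp (f (g • a)) (f (g • b)) q =
      gp a b p - c * gp (f a) (f b) q + ψ g a + ψ g b := by
    intro g a b hne
    have e1 := gp_smul g a b (g⁻¹ • p)
    have e2 := gp_smul g (f a) (f b) (g⁻¹ • q)
    rw [smul_inv_smul] at e1 e2
    have e3 := gp_sub_gp hne (g⁻¹ • p) p
    have e4 := gp_sub_gp (f.injective.ne hne) (g⁻¹ • q) q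
    simp only [hψ]
    rw [hf, hf, e1, e2]
    linear_combination e3 / 2 - c * e4 / 2
  have htr : ∀ a : Ends T₁, ∃ g : G, g • a₀ = a := by
    intro a
    by_cases h : a = b₀
    · obtain ⟨g, hg, -⟩ := h2 a₀ b₀ b₀ a₀ hab hab.symm
      exact ⟨g, hg.trans h.symm⟩
    · obtain ⟨g, hg, -⟩ := h2 a₀ b₀ a b₀ hab h
      exact ⟨g, hg⟩
  choose t ht using htr
  -- Vanishing on the stabiliser of `a₀` makes `ψ` the coboundary of `a ↦ ψ (t a) a₀`.
  have hw : ∀ g a, ψ g a = ψ (t (g • a)) a₀ - ψ (t a) a₀ := by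
    intro g a
    have e1 := hmul g (t a) a₀
    have e2 := hmul (t (g • a)) ((t (g • a))⁻¹ * (g * t a)) a₀
    have e3 : ((t (g • a))⁻¹ * (g * t a)) • a₀ = a₀ := by
      rw [mul_smul, mul_smul, ht, inv_smul_eq_iff, ht]
    rw [hfix _ _ e3, e3, mul_inv_cancel_left, e1, ht] at e2
    linarith
  -- After the coboundary is removed, the remaining function of pairs is constant by
  -- two-transitivity; half of the constant goes to each end.
  refine ⟨fun a => ψ (t a) a₀ + (gp a₀ b₀ p - c * gp (f a₀) (f b₀) q - ψ (t a₀) a₀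
    - ψ (t b₀) a₀) / 2, fun a b hne => ?_⟩
  obtain ⟨g, rfl, rfl⟩ := h2 a₀ b₀ a b hab hne
  have e1 := hgp g a₀ b₀ hab
  rw [hw g a₀, hw g b₀] at e1
  dsimp only
  linarith

/-- The ratio of the Gromov products can be chosen to be positive. -/
theorem exists_pos_potential {f : Ends T₁ ≃ Ends T₂}
    (hf : ∀ (g : G) (e : Ends T₁), f (g • e) = g • f e)
    (h2 : ∀ a b c d : Ends T₁, a ≠ b → c ≠ d → ∃ g : G, g • a = c ∧ g • b = d)
    (hfin₁ : ∀ x : T₁, Finite (Directions x)) (hfin₂ : ∀ x : T₂, Finite (Directions x))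
    {a b e : Ends T₁} (hab : a ≠ b) (hae : a ≠ e) (heb : e ≠ b) (p : T₁) (q : T₂) :
    ∃ c : ℝ, 0 < c ∧ ∃ v : Ends T₁ → ℝ, ∀ a b, a ≠ b →
      gp a b p = c * gp (f a) (f b) q + v a + v b := by
  obtain ⟨c, hc0, hc⟩ := exists_translation_ratio hf h2 hfin₁ hfin₂ hab hae heb p q
  by_cases htriv : ∀ (g : G) (d : Ends T₁), g • d = d → bus d (g • p) p = 0
  · refine ⟨1, one_pos, exists_potential hf h2 hab p q fun g d hd => ?_⟩
    have := hc g d hd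
    rw [htriv g d hd, zero_eq_mul] at this
    rw [htriv g d hd, this.resolve_left hc0, mul_zero]
  obtain ⟨v, hv⟩ := exists_potential hf h2 hab p q hc
  refine ⟨c, lt_of_not_ge fun hle => htriv ?_, v, hv⟩
  have hneg : c < 0 := lt_of_le_of_ne hle hc0
  intro g d hd
  by_contra hne
  obtain ⟨d', hdd, hd'⟩ := exists_second_fixed_end hd hne
  obtain ⟨s, hsd, hsd'⟩ : ∃ s, d ≠ s ∧ d' ≠ s := by
    by_contra! hcon
    have h1 : ∀ s s', d ≠ s → d ≠ s' → s = s' := fun s s' h h' =>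
      (hcon s h).symm.trans (hcon s' h')
    by_cases hda : d = a
    · exact heb (h1 e b (hda ▸ hae) (hda ▸ hab))
    · by_cases hdb : d = b
      · exact hae (h1 a e hda (hdb ▸ heb.symm))
      · exact hab (h1 a b hda hdb)
  have k1 : d ≠ g • s := fun h => hsd (MulAction.injective g (hd.trans h))
  have k2 : d' ≠ g • s := fun h => hsd' (MulAction.injective g (hd'.trans h))
  have e1 := gp_smul g d s (g⁻¹ • p)
  have e2 := gp_smul g d' s (g⁻¹ • p)
  rw [smul_inv_smul, hd] at e1
  rw [smul_inv_smul, hd'] at e2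
  have e3 := gp_sub_gp hsd (g⁻¹ • p) p
  have e4 := gp_sub_gp hsd' (g⁻¹ • p) p
  rw [bus_inv_smul hd] at e3
  rw [bus_inv_smul hd', bus_smul_other hdd.symm hd hd'] at e4
  -- The cross ratio of `d`, `d'`, `s`, `g • s` is, up to sign, the translation length of `g`, so it
  -- is nonzero.
  have hdiff : gp d (g • s) p - gp d' (g • s) p - (gp d s p - gp d' s p) ≠ 0 := by
    intro h
    exact hne (by linarith)
  have hs : s ≠ g • s := by
    intro h
    rw [← h] at hdiff
    exact hdiff (sub_self _)
  have q1 := gp_four_point hdd.symm hsd k1 hsd' k2 hs p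
  have q2 := gp_four_point (f.injective.ne hdd.symm) (f.injective.ne hsd) (f.injective.ne k1)
    (f.injective.ne hsd') (f.injective.ne k2) (f.injective.ne hs) q
  rw [hv _ _ hdd.symm, hv _ _ hsd, hv _ _ k1, hv _ _ hsd', hv _ _ k2, hv _ _ hs] at q1
  rw [hv _ _ hsd, hv _ _ k1, hv _ _ hsd', hv _ _ k2] at hdiff
  set A := gp (f d) (f d') q + gp (f s) (f (g • s)) q
  set B := gp (f d) (f s) q + gp (f d') (f (g • s)) q
  set C := gp (f d) (f (g • s)) q + gp (f d') (f s) q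
  have hBC : C - B ≠ 0 := by
    intro h
    refine hdiff ?_
    linear_combination c * h
  have q1' : (c * A = c * B ∧ c * A ≤ c * C) ∨ (c * A = c * C ∧ c * A ≤ c * B) ∨
      (c * B = c * C ∧ c * B ≤ c * A) := by
    rcases q1 with ⟨h, h'⟩ | ⟨h, h'⟩ | ⟨h, h'⟩
    · left
      constructor <;> simp only [A, B, C] <;> linarith
    · right; left
      constructor <;> simp only [A, B, C] <;> linarith
    · right; right
      constructor <;> simp only [A, B, C] <;> linarith
  -- The potential cancels, as each end occurs once in every sum. Dividing by `c < 0`, the tree `T₁`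
  -- makes the largest of `A`, `B`, `C` occur twice and `T₂` the smallest, so all are equal, against
  -- `B ≠ C`.
  simp only [mul_right_inj' hc0, mul_le_mul_left_of_neg hneg] at q1'
  refine hBC ?_
  rcases q1' with ⟨h, h'⟩ | ⟨h, h'⟩ | ⟨h, h'⟩ <;> rcases q2 with ⟨k, k'⟩ | ⟨k, k'⟩ | ⟨k, k'⟩ <;>
    linarith

end Proportional

/-! ### Rebuilding the isometry from Gromov products -/

section Reconstruction

variable {T₁ T₂ : Type*} [MetricSpace T₁] [IsRTree T₁] [MetricSpace T₂] [IsRTree T₂]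

/-- The prescribed values behave like Busemann values of a point: their pairwise sums are governed
by `gp` at `x`. The point `y` is placed on the line of `f a` and `f b`, for a line of `a` and `b`
through `x`. For another end, being opposite to `f a` or `f b` at `y` gives one inequality, and an
end opposite to it at `x` gives the other. -/
theorem exists_point {f : Ends T₁ ≃ Ends T₂} (leafless₁ : IsLeafless T₁) {p : T₁} {q : T₂}
    {c : ℝ} (hc : 0 < c) {v : Ends T₁ → ℝ}
    (hv : ∀ a b, a ≠ b → gp a b p = c * gp (f a) (f b) q + v a + v b) (x : T₁) :
    ∃ y : T₂, ∀ a, c * bus (f a) y q = bus a x p + 2 * v a := by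
  obtain ⟨a, b, hab, hx, -, -⟩ := leafless₁.exists_ends x x
  obtain ⟨y, hy, hya⟩ := exists_gp_eq_zero (f.injective.ne hab) q ((bus a x p + 2 * v a) / c)
  have hsum : ∀ d d', d ≠ d' → (bus d x p + 2 * v d) + (bus d' x p + 2 * v d') =
      2 * gp d d' x - 2 * (c * gp (f d) (f d') q) := by
    intro d d' h
    linarith [gp_sub_gp h x p, hv d d' h]
  have hsum' : ∀ d d', d ≠ d' → c * bus (f d) y q + c * bus (f d') y q =
      2 * (c * gp (f d) (f d') y) - 2 * (c * gp (f d) (f d') q) := by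
    intro d d' h
    rw [← mul_add, ← gp_sub_gp (f.injective.ne h)]
    ring
  have ha : c * bus (f a) y q = bus a x p + 2 * v a := by
    rw [hya]
    field_simp
  have hb : c * bus (f b) y q = bus b x p + 2 * v b := by
    have e1 := hsum a b hab
    have e2 := hsum' a b hab
    rw [hx] at e1
    rw [hy, mul_zero] at e2
    linarith
  have hle : ∀ d, c * bus (f d) y q ≤ bus d x p + 2 * v d := by
    intro d
    by_cases hda : a = d
    · exact hda ▸ ha.le
    by_cases hdb : d = b
    · exact hdb ▸ hb.le
    rcases gp_eq_zero_or (f.injective.ne hab) (f.injective.ne hda) (f.injective.ne hdb) hy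
      with h | h
    · have e1 := hsum a d hda
      have e2 := hsum' a d hda
      rw [h, mul_zero] at e2
      linarith [gp_nonneg hda x]
    · have e1 := hsum d b hdb
      have e2 := hsum' d b hdb
      rw [h, mul_zero] at e2
      linarith [gp_nonneg hdb x]
  refine ⟨y, fun d => le_antisymm (hle d) ?_⟩
  obtain ⟨d', hdd, h⟩ := leafless₁.exists_opposite x d
  have e1 := hsum d d' hdd
  have e2 := hsum' d d' hdd
  have e3 := hle d'
  have e4 := mul_nonneg hc.le (gp_nonneg (f.injective.ne hdd) y)
  rw [h] at e1
  linarith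

theorem exists_isRescaledIsometry {f : Ends T₁ ≃ Ends T₂} (leafless₁ : IsLeafless T₁)
    (leafless₂ : IsLeafless T₂) {p : T₁} {q : T₂} {c : ℝ} (hc : 0 < c) {v : Ends T₁ → ℝ}
    (hv : ∀ a b, a ≠ b → gp a b p = c * gp (f a) (f b) q + v a + v b) :
    ∃ (φ : T₁ → T₂) (h : IsRescaledIsometry c φ), h.endsMap = f := by
  choose φ hφ using exists_point leafless₁ hc hv
  have hbus : ∀ a x x', c * bus (f a) (φ x) (φ x') = bus a x x' := by
    intro a x x'
    rw [← bus_add (f a) (φ x) q (φ x'), ← bus_neg (f a) (φ x') q, mul_add, mul_neg, hφ, hφ]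
    linarith [bus_add a x p x', bus_neg a x' p]
  have hiso : IsRescaledIsometry c φ := by
    refine ⟨hc, fun y => ?_, fun x x' => le_antisymm ?_ ?_⟩
    · have hv' : ∀ a b, a ≠ b → gp a b q = c⁻¹ * gp (f.symm a) (f.symm b) p
          + -(c⁻¹ * v (f.symm a)) + -(c⁻¹ * v (f.symm b)) := by
        intro a b hab
        rw [hv _ _ (f.symm.injective.ne hab), Equiv.apply_symm_apply, Equiv.apply_symm_apply]
        field_simp
        ring
      obtain ⟨x, hx⟩ := exists_point leafless₂ (inv_pos.2 hc) hv' y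
      refine ⟨x, leafless₂.eq_of_bus fun e => ?_⟩
      have e1 := hx e
      have e2 := hφ x (f.symm e)
      rw [Equiv.apply_symm_apply] at e2
      have e3 : c * bus e y q = bus (f.symm e) x p + 2 * v (f.symm e) := by
        field_simp at e1
        linarith
      have e4 : c * bus e (φ x) y = 0 := by
        rw [← bus_add e (φ x) q y, ← bus_neg e y q]
        linarith
      exact (mul_eq_zero.1 e4).resolve_left hc.ne'
    · obtain ⟨a, -, -, -, -, hd⟩ := leafless₂.exists_ends (φ x) (φ x')
      rw [← hd, ← f.apply_symm_apply a, hbus]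
      exact bus_le_dist _ _ _
    · obtain ⟨a, -, -, -, -, hd⟩ := leafless₁.exists_ends x x'
      rw [← hd, ← hbus]
      exact mul_le_mul_of_nonneg_left (bus_le_dist _ _ _) hc.le
  refine ⟨φ, hiso, funext fun e => Ends.ext_bus fun y y' => ?_⟩
  obtain ⟨x, rfl⟩ := hiso.surjective y
  obtain ⟨x', rfl⟩ := hiso.surjective y'
  exact mul_left_cancel₀ hc.ne' ((hiso.bus_endsMap e x x').trans (hbus e x x').symm)

theorem IsBranchPoint.exists_ends {T : Type*} [MetricSpace T] [IsRTree T] {x : T}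
    (h : IsBranchPoint x) : ∃ a b e : Ends T, a ≠ b ∧ a ≠ e ∧ e ≠ b ∧
      gp a b x = 0 ∧ gp a e x = 0 ∧ gp e b x = 0 := by
  obtain ⟨d₁, d₂, d₃, h1, h2, h3⟩ := exists_three_of_three_le (α := Directions x) h
  obtain ⟨a, rfl⟩ := dir_surjective x d₁
  obtain ⟨b, rfl⟩ := dir_surjective x d₂
  obtain ⟨e, rfl⟩ := dir_surjective x d₃
  have n1 : a ≠ b := fun h => h1 (by rw [h])
  have n2 : a ≠ e := fun h => h2 (by rw [h])
  have n3 : e ≠ b := fun h => h3 (by rw [h])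
  exact ⟨a, b, e, n1, n2, n3, (dir_ne_iff n1).1 h1, (dir_ne_iff n2).1 h2, (dir_ne_iff n3).1 h3⟩

/-- A branch point is the centre of three ends, and its image must be the centre of their images,
which depends on `f` only. -/
theorem IsBranchPoint.apply_eq {f : Ends T₁ → Ends T₂} (hf : Function.Injective f) {x : T₁}
    (hx : IsBranchPoint x) {c c' : ℝ} {φ φ' : T₁ → T₂} (h : IsRescaledIsometry c φ)
    (h' : IsRescaledIsometry c' φ') (hφ : h.endsMap = f) (hφ' : h'.endsMap = f) :
    φ x = φ' x := by
  obtain ⟨a, b, e, hab, hae, heb, h1, h2, h3⟩ := hx.exists_ends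
  have key : ∀ {c : ℝ} {φ : T₁ → T₂} (h : IsRescaledIsometry c φ), h.endsMap = f →
      ∀ a b, gp a b x = 0 → gp (f a) (f b) (φ x) = 0 := by
    intro c φ h hφ a b hz
    have := h.gp_endsMap a b x
    rw [hφ, hz] at this
    exact (mul_eq_zero.1 this).resolve_left h.pos.ne'
  exact center_unique (hf.ne hab) (hf.ne hae) (hf.ne heb) (key h hφ _ _ h1) (key h hφ _ _ h2)
    (key h hφ _ _ h3) (key h' hφ' _ _ h1) (key h' hφ' _ _ h2) (key h' hφ' _ _ h3)

end Reconstruction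

end RTree

/-! ### Existence and uniqueness -/

theorem mainTheorem1 {G T₁ T₂ : Type*} [Group G]
    [MetricSpace T₁] [RTree.IsRTree T₁] [MetricSpace T₂] [RTree.IsRTree T₂]
    [MulAction G T₁] [IsIsometricSMul G T₁] [MulAction G T₂] [IsIsometricSMul G T₂]
    (leafless₁ : RTree.IsLeafless T₁) (leafless₂ : RTree.IsLeafless T₂)
    (locallyFinite₁ : RTree.IsLocallyFinite T₁) (locallyFinite₂ : RTree.IsLocallyFinite T₂)
    (threeEnds₁ : 3 ≤ Cardinal.mk (RTree.Ends T₁))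
    (threeEnds₂ : 3 ≤ Cardinal.mk (RTree.Ends T₂))
    (twoTransitive : MulAction.IsMultiplyPretransitive G (RTree.Ends T₁) 2)
    (f : RTree.Ends T₁ → RTree.Ends T₂) (f_bijective : Function.Bijective f)
    (f_equivariant : ∀ (g : G) (e : RTree.Ends T₁), f (g • e) = g • f e) :
    (∃ (c : ℝ) (φ : T₁ → T₂) (h : RTree.IsRescaledIsometry c φ), h.endsMap = f) ∧
    ((∃ x y : T₁, x ≠ y ∧ RTree.IsBranchPoint x ∧ RTree.IsBranchPoint y) →
      ∀ (c c' : ℝ) (φ φ' : T₁ → T₂)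
        (h : RTree.IsRescaledIsometry c φ) (h' : RTree.IsRescaledIsometry c' φ'),
        h.endsMap = f → h'.endsMap = f → c = c' ∧ φ = φ') := by
  constructor
  · obtain ⟨a, b, e, hab, hae, heb⟩ := RTree.exists_three_of_three_le threeEnds₁
    obtain ⟨γ, -⟩ := RTree.exists_conv a
    obtain ⟨γ', -⟩ := RTree.exists_conv (f a)
    obtain ⟨c, hc, v, hv⟩ := RTree.exists_pos_potential (f := Equiv.ofBijective f f_bijective)
      f_equivariant (fun _ _ _ _ h h' => MulAction.is_two_pretransitive_iff.1 twoTransitive h h')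
      (fun x => Cardinal.lt_aleph0_iff_finite.1 (locallyFinite₁ x))
      (fun x => Cardinal.lt_aleph0_iff_finite.1 (locallyFinite₂ x)) hab hae heb (γ 0) (γ' 0)
    obtain ⟨φ, h, hφ⟩ := RTree.exists_isRescaledIsometry leafless₁ leafless₂ hc hv
    exact ⟨c, φ, h, hφ⟩
  · rintro ⟨x, y, hxy, hx, hy⟩ c c' φ φ' h h' hφ hφ'
    have ex := hx.apply_eq f_bijective.injective h h' hφ hφ'
    have ey := hy.apply_eq f_bijective.injective h h' hφ hφ'
    -- The distance between the images of two branch points is known, and it determines the scale.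
    have hcc : c = c' := by
      refine mul_right_cancel₀ (dist_ne_zero.2 (h.injective.ne hxy)) ?_
      rw [h.dist_eq, ex, ey, h'.dist_eq]
    -- Any other point is recognised by its Busemann values relative to the branch point `x`.
    refine ⟨hcc, funext fun z => leafless₂.eq_of_bus fun e => ?_⟩
    obtain ⟨e, rfl⟩ := f_bijective.surjective e
    have e1 := h.bus_endsMap e z x
    have e2 := h'.bus_endsMap e z x
    rw [hφ] at e1
    rw [hφ', ← hcc, ← e1, ← ex] at e2
    have e3 := mul_left_cancel₀ h.pos.ne' e2
    rw [← RTree.bus_add (f e) (φ z) (φ x) (φ' z), ← RTree.bus_neg (f e) (φ' z) (φ x), e3,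
      add_neg_cancel]
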